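/- **Setting.** Let $G$ be one of the following, acting isometrically on $L^2(\mathbb R)=L^2(\mathbb R;\mathbb C)$, with its left Haar measure $\mu$: the translation group $(\mathbb R,+)$, $\rho(\tau)x(t)=x(t+\tau)$, $d\mu=d\tau$; the affine group $\{(a,b):a>0,\ b\in\mathbb R\}$, $\rho(a,b)x(t)=a^{-1/2}x((t-b)/a)$, $d\mu=a^{-2}\,da\,db$; or the time-frequency plane $H/Z\cong\mathbb R^2$ of the Heisenberg–Weyl group, $\rho(\tau,\nu)x(t)=e^{2\pi i\nu t}x(t-\tau)$, $d\mu=d\tau\,d\nu$. Let $\hat u(\omega)=\int u(t)e^{-2\pi i\omega t}\,dt$ (extended to $L^2$), and let $\langle\cdot,\cdot\rangle$ be the inner product of $L^2(\mathbb R)$, linear in the second argument. For $x\in L^2(\mathbb R)$ put $q_x(u)=\int_G|\langle\rho(g)x,u\rangle|^2d\mu(g)\in[0,\infty]$, $D_x=\{u: q_x(u)<\infty\}$ and $B_x(v,u)=\int_G\langle v,\rho(g)x\rangle\langle\rho(g)x,u\rangle\,d\mu(g)$ for $u,v\in D_x$. The group-averaged estimator $\mathcal F_G(x)=\int_G\rho(g)x\otimes(\rho(g)x)^*\,d\mu(g)$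 is the (in general unbounded) operator with $\mathcal F_G(x)u=w$ iff $u\in D_x$, $w\in\overline{D_x}$ and $B_x(v,u)=\langle v,w\rangle$ for all $v\in D_x$. For a random $X$ in $L^2(\mathbb R)$ and an operator $A$, the equality $E[\mathcal F_G(X)]=A$ means that $E[q_X(u)]<\infty$ and $E[B_X(v,u)]=\langle v,Au\rangle$ for all $u,v$ in the domain of $A$. Let $C_\rho$ be the operator $\widehat{C_\rho u}(\omega)=|\omega|^{-1/2}\hat u(\omega)$ with its natural domain. The noise operator $\mathcal N_G$ is the identity for $(\mathbb R,+)$ and $H/Z$, and $C_\rho^{-2}$ for the affine group. **Theorem (Continuous Replacement Theorem).** Let $x=s+n$, where (C1) $s\in S$ is deterministic and $S\subset L^2(\mathbb R)$ is a closed subspace (for instance a finite-dimensional one) with $\rho(g)S\subset S$ for all $g\in G$; $n$ is a random element of $L^2(\mathbb R)$ with mean zero, i.e. $\langle u,n\rangle$ is integrable with mean $0$ for every $u\in L^2(\mathbb R)$. Let $\sigma\in\mathbb R$ and consider the condition (C2) $E[\mathcal F_G(n)]=\sigma^2\mathcal N_G$. Then: 1. *(Decomposition)* For all $u\in L^2(\mathbb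 R)$, $E[q_x(u)]=q_s(u)+E[q_n(u)]$ in $[0,\infty]$. The cross term $\mathcal C_{sn}=\int_G[\rho(g)s\otimes(\rho(g)n)^*+\rho(g)n\otimes(\rho(g)s)^*]\,d\mu(g)$ satisfies $E\langle v,\mathcal C_{sn}u\rangle=0$ for all $u,v$ at which $q_s$ and $E[q_n]$ are finite. Under (C2), $E[\mathcal F_G(x)]=\mathcal F_G(s)+\sigma^2\mathcal N_G$. 2. *(Signal concentration)* The range of $\mathcal F_G(s)$ is contained in $S$. If $\dim S<\infty$, then $\operatorname{rank}\mathcal F_G(s)=\dim S$. 3. *(Noise structure)* For $(\mathbb R,+)$ and $H/Z$ the noise floor is flat: under (C2), $E[q_x(u)]=q_s(u)+\sigma^2\|u\|^2$ for all $u\in L^2(\mathbb R)$. For the affine group, $C_\rho$ is self-adjoint and positive, and it restricts to the Duflo–Moore operator on each of $L^2_\pm(\mathbb R)=\{u:\hat u=0 \text{ a.e. on } \mp\omega>0\}$: it maps its domain in $L^2_\pm(\mathbb R)$ into $L^2_\pm(\mathbb R)$; a $\psi\in L^2_\pm(\mathbb R)$ is in its domain iff $\int_G|\langle\rho(g)\psi,\psi\rangle|^2d\mu(g)<\infty$;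 and $\int_G\langle\phi_1,\rho(g)\psi_1\rangle\langle\rho(g)\psi_2,\phi_2\rangle\,d\mu(g)=\langle C_\rho\psi_2,C_\rho\psi_1\rangle\langle\phi_1,\phi_2\rangle$, with absolute convergence, for $\psi_1,\psi_2$ in its domain in $L^2_\pm(\mathbb R)$ and $\phi_1,\phi_2\in L^2_\pm(\mathbb R)$. Moreover $\mathcal N_G=C_\rho^{-2}$ is multiplication by $|\omega|$ in the frequency domain, with its natural domain, and under (C2), $E[q_x(u)]=q_s(u)+\sigma^2\int|\omega||\hat u(\omega)|^2d\omega$ for all $u$ in the domain of $\mathcal N_G$. 4. *(Subspace separation)* Fix any realization of $n$ and consider noise scaled by $t_k\in\mathbb R$. (a) If $\mathcal F_G(n)$ is bounded, in the sense that $q_n(u)\le K\|u\|^2$ for some $K$ and all $u$, and $v_k$ are unit eigenfunctions of $\mathcal F_G(s+t_kn)$ with eigenvalues $\lambda_k>0$ such that $t_k^2/\lambda_k\to0$, then $\operatorname{dist}(v_k,S)\to0$. (b) If $d=\dim S<\infty$, $t_k\to0$, and $v_{k,1},\dots,v_{k,d}$ are orthonormal eigenfunctions of $\mathcal F_G(s+t_kn)$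 for its $d$ largest eigenvalues, then $\operatorname{dist}(v_{k,i},S)\to0$ for every $i$, and $\operatorname{dist}(f,\operatorname{span}(v_{k,1},\dots,v_{k,d}))\to0$ for every $f\in S$. *Remark.* For these three groups $S=\{0\}$ is the only finite-dimensional invariant subspace of $L^2(\mathbb R)$, so the statements for $\dim S<\infty$ concern that case only; the others hold for every closed invariant $S$. For the affine group, (C2) can hold only with $\sigma=0$; the first formula of part 1 does not use (C2). -/

import Mathlib

open MeasureTheory Filter Topology FourierTransform
open scoped ENNReal

noncomputable section

/-- The signal space `L²(ℝ)` of complex waveforms. -/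
abbrev Waveform : Type := Lp ℂ 2 (volume : Measure ℝ)

/-! ### Time shifts, dilations and modulations on `L²(ℝ)` -/

lemma map_affine_volume {a : ℝ} (ha : 0 < a) (b : ℝ) :
    Measure.map (fun t : ℝ => (t - b) / a) volume = ENNReal.ofReal a • (volume : Measure ℝ) := by
  have h1 : (fun t : ℝ => (t - b) / a) = (fun t => a⁻¹ * t) ∘ (fun t => t - b) := by
    funext t; simp [div_eq_inv_mul]
  rw [h1, ← Measure.map_map (measurable_const_mul _) (measurable_sub_const b),
    (measurePreserving_sub_right volume b).map_eq, Real.map_volume_mul_left (inv_ne_zero ha.ne')]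
  simp [abs_of_pos ha]

/-- The function `t ↦ a^{-1/2} e^{2πiνt} x((t - b)/a)`. -/
def atomFun (a b ν : ℝ) (x : ℝ → ℂ) (t : ℝ) : ℂ :=
  ((a ^ (-(1 / 2) : ℝ) : ℝ) : ℂ) * Complex.exp (2 * Real.pi * Complex.I * ν * t) * x ((t - b) / a)

lemma ae_atom {a : ℝ} (ha : 0 < a) (b : ℝ) {p : ℝ → Prop} (h : ∀ᵐ t, p t) :
    ∀ᵐ t : ℝ, p ((t - b) / a) := by
  have hm : Measurable fun t : ℝ => (t - b) / a := by fun_prop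
  refine ae_of_ae_map hm.aemeasurable ?_
  rw [map_affine_volume ha b]
  exact Measure.ae_smul_measure h _

lemma eLpNorm_atomFun {a : ℝ} (ha : 0 < a) (b ν : ℝ) {x : ℝ → ℂ}
    (hx : AEStronglyMeasurable x volume) :
    eLpNorm (atomFun a b ν x) 2 volume = eLpNorm x 2 volume := by
  have hm : Measurable fun t : ℝ => (t - b) / a := by fun_prop
  have hx' : AEStronglyMeasurable x (Measure.map (fun t : ℝ => (t - b) / a) volume) := by
    rw [map_affine_volume ha b]; exact hx.smul_measure _
  have h1 : eLpNorm (atomFun a b ν x) 2 volume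
      = eLpNorm ((a ^ (-(1 / 2) : ℝ) : ℝ) • (x ∘ fun t : ℝ => (t - b) / a)) 2 volume := by
    refine eLpNorm_congr_norm_ae (Eventually.of_forall fun t => ?_)
    have : ‖Complex.exp (2 * Real.pi * Complex.I * ν * t)‖ = 1 := by
      have := Complex.norm_exp_ofReal_mul_I (2 * Real.pi * ν * t)
      rw [← this]; congr 2; push_cast; ring
    simp only [atomFun, norm_mul, this, Pi.smul_apply, norm_smul, Function.comp, mul_one,
      Complex.norm_real]
  rw [h1, eLpNorm_const_smul, ← eLpNorm_map_measure hx' hm.aemeasurable, map_affine_volume ha b,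
    eLpNorm_smul_measure_of_ne_top (by simp), smul_eq_mul, ← mul_assoc]
  have h2 : ‖(a ^ (-(1 / 2) : ℝ) : ℝ)‖ₑ * ENNReal.ofReal a ^ (1 / (2 : ℝ≥0∞)).toReal = 1 := by
    rw [Real.enorm_of_nonneg (by positivity), ENNReal.ofReal_rpow_of_pos ha,
      ← ENNReal.ofReal_mul (by positivity), ← Real.rpow_add ha]
    norm_num
  rw [h2, one_mul]

lemma aestronglyMeasurable_atomFun {a : ℝ} (ha : 0 < a) (b ν : ℝ) {x : ℝ → ℂ}
    (hx : AEStronglyMeasurable x volume) : AEStronglyMeasurable (atomFun a b ν x) volume := by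
  have hm : Measurable fun t : ℝ => (t - b) / a := by fun_prop
  have hx' : AEStronglyMeasurable x (Measure.map (fun t : ℝ => (t - b) / a) volume) := by
    rw [map_affine_volume ha b]; exact hx.smul_measure _
  have h1 : AEStronglyMeasurable (fun t : ℝ => ((a ^ (-(1 / 2) : ℝ) : ℝ) : ℂ) *
      Complex.exp (2 * Real.pi * Complex.I * ν * t)) volume :=
    Continuous.aestronglyMeasurable (by fun_prop)
  exact h1.mul (hx'.comp_aemeasurable hm.aemeasurable)

lemma memLp_atomFun {a : ℝ} (ha : 0 < a) (b ν : ℝ) (x : Waveform) :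
    MemLp (atomFun a b ν x) 2 volume :=
  ⟨aestronglyMeasurable_atomFun ha b ν (Lp.aestronglyMeasurable x), by
    rw [eLpNorm_atomFun ha b ν (Lp.aestronglyMeasurable x)]; exact Lp.eLpNorm_lt_top x⟩

/-- The isometry `x(t) ↦ a^{-1/2} e^{2πiνt} x((t - b)/a)` of `L²(ℝ)`, for `a > 0`. -/
def atomOp (a : Set.Ioi (0 : ℝ)) (b ν : ℝ) : Waveform →ₗᵢ[ℂ] Waveform where
  toFun x := (memLp_atomFun a.2 b ν x).toLp _
  map_add' x y := by
    rw [← MemLp.toLp_add]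
    refine MemLp.toLp_congr _ _ ?_
    filter_upwards [ae_atom a.2 b (Lp.coeFn_add x y)] with t ht
    simp only [atomFun, Pi.add_apply, ht]; ring
  map_smul' c x := by
    rw [RingHom.id_apply, ← MemLp.toLp_const_smul]
    refine MemLp.toLp_congr _ _ ?_
    filter_upwards [ae_atom a.2 b (Lp.coeFn_smul c x)] with t ht
    simp only [atomFun, Pi.smul_apply, ht, smul_eq_mul]; ring
  norm_map' x := by
    change ‖(memLp_atomFun a.2 b ν x).toLp _‖ = ‖x‖
    rw [Lp.norm_toLp, eLpNorm_atomFun a.2 b ν (Lp.aestronglyMeasurable x), Lp.norm_def]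

/-! ### The three groups, their Haar measures and their representations -/

/-- The three groups: translations `(ℝ, +)`, the affine group `ℝ⁺ ⋉ ℝ`, and the time-frequency
plane `H/Z` of the Heisenberg-Weyl group. -/
inductive WaveformGroup
  | translation
  | affine
  | timeFrequency

namespace WaveformGroup

/-- Group elements: `τ`, respectively `(a, b)` with `a > 0`, respectively `(τ, ν)`. -/
def Elt : WaveformGroup → Type
  | translation => ℝ
  | affine => Set.Ioi (0 : ℝ) × ℝ
  | timeFrequency => ℝ × ℝ

instance instMeasurableSpaceElt : (G : WaveformGroup) → MeasurableSpace G.Elt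
  | translation => inferInstanceAs (MeasurableSpace ℝ)
  | affine => inferInstanceAs (MeasurableSpace (Set.Ioi (0 : ℝ) × ℝ))
  | timeFrequency => inferInstanceAs (MeasurableSpace (ℝ × ℝ))

/-- Left Haar measure: `dτ`, respectively `a⁻² da db`, respectively `dτ dν`. -/
def haar : (G : WaveformGroup) → Measure G.Elt
  | translation => (volume : Measure ℝ)
  | affine => ((Measure.comap Subtype.val (volume : Measure ℝ)).prod
      (volume : Measure ℝ)).withDensity fun g : Set.Ioi (0 : ℝ) × ℝ => ENNReal.ofReal (((g.1 : ℝ) ^ 2)⁻¹)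
  | timeFrequency => (volume : Measure (ℝ × ℝ))

/-- The action on `L²(ℝ)`: `x(t + τ)`, respectively `a^{-1/2} x((t - b)/a)`, respectively
`e^{2πiνt} x(t - τ)`. -/
def rep : (G : WaveformGroup) → G.Elt → Waveform →ₗᵢ[ℂ] Waveform
  | translation => fun τ : ℝ => atomOp ⟨1, Set.mem_Ioi.2 one_pos⟩ (-τ) 0
  | affine => fun g : Set.Ioi (0 : ℝ) × ℝ => atomOp g.1 g.2 0
  | timeFrequency => fun g : ℝ × ℝ => atomOp ⟨1, Set.mem_Ioi.2 one_pos⟩ g.1 g.2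

end WaveformGroup

/-! ### The group-averaged estimator

`F_G(x) = ∫_G ρ(g)x ⊗ (ρ(g)x)* dμ(g)` is read as a weak integral: `⟨v, F_G(x) u⟩` is the integral
of `⟨v, ρ(g)x⟩ ⟨ρ(g)x, u⟩`, for `u`, `v` with square-integrable coefficients. Mathlib's inner
product is linear in its second argument. -/

section Estimator

variable (G : WaveformGroup)

/-- `⟨u, F_G(x) u⟩ = ∫_G |⟨ρ(g)x, u⟩|² dμ(g)`, a value in `[0, ∞]`. -/
def energy (x u : Waveform) : ℝ≥0∞ :=
  ∫⁻ g, ‖inner ℂ (G.rep g x) u‖ₑ ^ 2 ∂G.haar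

/-- `⟨v, F_G(x) u⟩ = ∫_G ⟨v, ρ(g)x⟩ ⟨ρ(g)x, u⟩ dμ(g)`. -/
def estForm (x v u : Waveform) : ℂ :=
  ∫ g, inner ℂ v (G.rep g x) * inner ℂ (G.rep g x) u ∂G.haar

/-- `⟨v, C u⟩` for the cross term
`C = ∫_G [ρ(g)s ⊗ (ρ(g)n)* + ρ(g)n ⊗ (ρ(g)s)*] dμ(g)`. -/
def crossForm (s n v u : Waveform) : ℂ :=
  ∫ g, (inner ℂ v (G.rep g s) * inner ℂ (G.rep g n) u
    + inner ℂ v (G.rep g n) * inner ℂ (G.rep g s) u) ∂G.haar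

/-- The `u` for which `g ↦ ⟨ρ(g)x, u⟩` is square-integrable on the group. -/
def formDomain (x : Waveform) : Submodule ℂ Waveform where
  carrier := {u | MemLp (fun g => inner ℂ (G.rep g x) u) 2 G.haar}
  add_mem' {u v} hu hv := by
    have h := MemLp.add (f := fun g => inner ℂ (G.rep g x) u)
      (g := fun g => inner ℂ (G.rep g x) v) hu hv
    refine h.ae_eq (Eventually.of_forall fun g => ?_)
    simp only [Pi.add_apply, inner_add_right]
  zero_mem' := by simp
  smul_mem' c u hu := by
    have h := MemLp.const_mul (f := fun g => inner ℂ (G.rep g x) u) hu c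
    refine h.ae_eq (Eventually.of_forall fun g => ?_)
    simp only [inner_smul_right]

lemma integrable_estForm {x u v : Waveform} (hu : u ∈ formDomain G x) (hv : v ∈ formDomain G x) :
    Integrable (fun g => inner ℂ v (G.rep g x) * inner ℂ (G.rep g x) u) G.haar := by
  have hv' : MemLp (fun g => inner ℂ v (G.rep g x)) 2 G.haar := by
    have h : MemLp (fun g => inner ℂ (G.rep g x) v) 2 G.haar := hv
    refine h.star.ae_eq (Eventually.of_forall fun g => ?_)
    simp only [Pi.star_apply, RCLike.star_def, inner_conj_symm]
  exact hv'.integrable_mul hu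

/-- The graph of `F_G(x)`: the pairs `(u, w)` with `⟨v, w⟩ = ⟨v, F_G(x) u⟩` for all `v` in the form
domain. The closure condition makes `w` unique; it is no restriction if the form domain is dense,
that is, if the integral defines a densely defined form. -/
def estGraph (x : Waveform) : Submodule ℂ (Waveform × Waveform) where
  carrier := {p | p.1 ∈ formDomain G x ∧ p.2 ∈ (formDomain G x).topologicalClosure ∧
    ∀ v ∈ formDomain G x, estForm G x v p.1 = inner ℂ v p.2}
  add_mem' {p q} hp hq := by
    refine ⟨add_mem hp.1 hq.1, add_mem hp.2.1 hq.2.1, fun v hv => ?_⟩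
    have h := integral_add (integrable_estForm G hp.1 hv) (integrable_estForm G hq.1 hv)
    simp only [Prod.fst_add, Prod.snd_add, inner_add_right, ← hp.2.2 v hv, ← hq.2.2 v hv, estForm,
      mul_add]
    exact h
  zero_mem' := ⟨zero_mem _, zero_mem _, fun v _ => by simp [estForm]⟩
  smul_mem' c p hp := by
    refine ⟨Submodule.smul_mem _ c hp.1, Submodule.smul_mem _ c hp.2.1, fun v hv => ?_⟩
    simp only [Prod.smul_fst, Prod.smul_snd, inner_smul_right, ← hp.2.2 v hv, estForm]
    rw [← integral_const_mul]
    exact integral_congr_ae (Eventually.of_forall fun g => by simp only []; ring)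

lemma estGraph_functional (x : Waveform) (p : Waveform × Waveform) (hp : p ∈ estGraph G x)
    (h0 : p.1 = 0) : p.2 = 0 := by
  obtain ⟨-, h2, h3⟩ := hp
  have hv : ∀ v ∈ formDomain G x, inner ℂ v p.2 = 0 := fun v hv => by
    rw [← h3 v hv, h0]; simp [estForm]
  have hcl : p.2 ∈ ((formDomain G x).topologicalClosure)ᗮ := by
    rw [Submodule.orthogonal_closure]; exact (Submodule.mem_orthogonal _ _).2 hv
  exact inner_self_eq_zero.1 ((Submodule.mem_orthogonal _ _).1 hcl _ h2)

/-- The group-averaged estimator `F_G(x)`, in general an unbounded operator on `L²(ℝ)`. -/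
def estimator (x : Waveform) : Waveform →ₗ.[ℂ] Waveform := (estGraph G x).toLinearPMap

/-- `E[F_G(X)] = A` weakly on the domain of `A`, for a random waveform `X`. -/
def HasMeanEstimator {Ω : Type*} [MeasurableSpace Ω] (P : Measure Ω) (X : Ω → Waveform)
    (A : Waveform →ₗ.[ℂ] Waveform) : Prop :=
  (∀ u : A.domain, ∫⁻ ω, energy G (X ω) u ∂P < ∞) ∧
  ∀ u v : A.domain, Integrable (fun ω => estForm G (X ω) v u) P ∧
    ∫ ω, estForm G (X ω) v u ∂P = inner ℂ (v : Waveform) (A u)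

end Estimator

/-! ### Fourier multipliers, the Duflo-Moore operator and the noise operator -/

/-- The operator `u ↦ w` with `ŵ = m û`, on its natural domain `{u : m û ∈ L²(ℝ)}`; here
`û(ω) = ∫ u(t) e^{-2πiωt} dt` is the unitary Fourier transform. -/
def fourierMultiplier (m : ℝ → ℝ) : Waveform →ₗ.[ℂ] Waveform :=
  Submodule.toLinearPMap
    { carrier := {p | ∀ᵐ ω : ℝ, (𝓕 p.2 : Waveform) ω = m ω * (𝓕 p.1 : Waveform) ω}
      add_mem' := fun {p q} hp hq => by
        simp only [Set.mem_ofPred_eq, Prod.fst_add, Prod.snd_add, FourierTransform.fourier_add]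
        filter_upwards [hp, hq, Lp.coeFn_add (𝓕 p.1 : Waveform) (𝓕 q.1),
          Lp.coeFn_add (𝓕 p.2 : Waveform) (𝓕 q.2)] with ω h1 h2 h3 h4
        rw [h3, h4, Pi.add_apply, Pi.add_apply, h1, h2, mul_add]
      zero_mem' := by
        have h : (𝓕 (0 : Waveform) : Waveform) = 0 := (Lp.fourierTransformₗᵢ ℝ ℂ).map_zero
        simp only [Set.mem_ofPred_eq, Prod.fst_zero, Prod.snd_zero, h]
        filter_upwards [Lp.coeFn_zero ℂ 2 (volume : Measure ℝ)] with ω h1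
        rw [h1]; simp
      smul_mem' := fun c p hp => by
        simp only [Set.mem_ofPred_eq, Prod.smul_fst, Prod.smul_snd, FourierTransform.fourier_smul]
        filter_upwards [hp, Lp.coeFn_smul c (𝓕 p.1 : Waveform),
          Lp.coeFn_smul c (𝓕 p.2 : Waveform)] with ω h1 h2 h3
        rw [h2, h3, Pi.smul_apply, Pi.smul_apply, h1]; simp only [smul_eq_mul]; ring }

/-- `L²₊(ℝ)`: the waveforms whose Fourier transform vanishes on `ω < 0`. -/
def positiveFrequency : Set Waveform := {x | ∀ᵐ ω : ℝ, ω < 0 → (𝓕 x : Waveform) ω = 0}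

/-- `L²₋(ℝ)`: the waveforms whose Fourier transform vanishes on `ω > 0`. -/
def negativeFrequency : Set Waveform := {x | ∀ᵐ ω : ℝ, 0 < ω → (𝓕 x : Waveform) ω = 0}

/-- `C` restricts on the invariant subspace `K` to the Duflo-Moore operator of `G`: its domain in
`K` consists of the admissible vectors, and the Duflo-Moore orthogonality relations hold. -/
structure IsDufloMooreOn (G : WaveformGroup) (K : Set Waveform) (C : Waveform →ₗ.[ℂ] Waveform) :
    Prop where
  mapsTo : ∀ ψ : C.domain, (ψ : Waveform) ∈ K → C ψ ∈ K
  mem_domain_iff : ∀ ψ ∈ K,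
    ψ ∈ C.domain ↔ MemLp (fun g => inner ℂ (G.rep g ψ) ψ) 2 G.haar
  orthogonality : ∀ ψ₁ ψ₂ : C.domain, (ψ₁ : Waveform) ∈ K → (ψ₂ : Waveform) ∈ K →
    ∀ φ₁ ∈ K, ∀ φ₂ ∈ K,
      Integrable (fun g => inner ℂ φ₁ (G.rep g ψ₁) * inner ℂ (G.rep g ψ₂) φ₂) G.haar ∧
      ∫ g, inner ℂ φ₁ (G.rep g ψ₁) * inner ℂ (G.rep g ψ₂) φ₂ ∂G.haar
        = inner ℂ (C ψ₂) (C ψ₁) * inner ℂ φ₁ φ₂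

/-- The operator `C⁻²` of an injective operator `C`: `C⁻² u = w` means `u = C (C w)`. -/
def inverseSquare (C : Waveform →ₗ.[ℂ] Waveform) : Waveform →ₗ.[ℂ] Waveform :=
  Submodule.toLinearPMap
    { carrier := {p | ∃ y : Waveform, (p.2, y) ∈ C.graph ∧ (y, p.1) ∈ C.graph}
      add_mem' := fun {_ _} ⟨y, h1, h2⟩ ⟨z, h3, h4⟩ => ⟨y + z, add_mem h1 h3, add_mem h2 h4⟩
      zero_mem' := ⟨0, zero_mem C.graph, zero_mem C.graph⟩
      smul_mem' := fun c _ ⟨y, h1, h2⟩ =>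
        ⟨c • y, C.graph.smul_mem c h1, C.graph.smul_mem c h2⟩ }

/-- The Duflo-Moore operator `C_ρ` of the affine group: multiplication by `|ω|^{-1/2}` in the
frequency domain. -/
def affineDufloMoore : Waveform →ₗ.[ℂ] Waveform :=
  fourierMultiplier fun ω => |ω| ^ (-(1 / 2) : ℝ)

/-- The noise operator `N_G`: the identity for the unimodular groups, `C_ρ⁻²` for the affine
group. -/
def noiseOperator : WaveformGroup → (Waveform →ₗ.[ℂ] Waveform)
  | .translation => LinearMap.id.toPMap ⊤
  | .affine => inverseSquare affineDufloMoore
  | .timeFrequency => LinearMap.id.toPMap ⊤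

/-! ### Eigenfunctions -/

/-- `v ≠ 0` lies in the domain of `A` and `A v = l v`. -/
def IsEigenfunction (A : Waveform →ₗ.[ℂ] Waveform) (l : ℝ) (v : Waveform) : Prop :=
  v ≠ 0 ∧ (v, (l : ℂ) • v) ∈ A.graph

/-- `v` is an orthonormal family of eigenfunctions of `A` for its `d` largest eigenvalues, counted
with multiplicity: no eigenfunction orthogonal to the family has an eigenvalue exceeding one of
theirs. -/
def IsTopEigenfamily (A : Waveform →ₗ.[ℂ] Waveform) {d : ℕ} (v : Fin d → Waveform) : Prop :=
  Orthonormal ℂ v ∧ ∃ l : Fin d → ℝ, (∀ i, IsEigenfunction A (l i) (v i)) ∧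
    ∀ (m : ℝ) (w : Waveform), IsEigenfunction A m w → (∀ i, inner ℂ (v i) w = 0) → ∀ i, m ≤ l i

end

noncomputable section

/-! ### Measurability of the coefficients and elementary properties of the energy -/

/-! Decomposition. For fixed g the coefficient of s + n is a constant c plus a mean-zero variable Y,
so E|c + Y|² = |c|² + E|Y|², also when both sides are infinite (`lintegral_enorm_const_add_sq`).
Tonelli over Ω × G gives the formula for energies, and Fubini gives the vanishing of the cross term,
which is integrable on Ω × G as a sum of products of square-integrable functions.

Signal and separation. If w ⊥ S, invariance gives ⟨ρ(g)s, w⟩ = 0 for all g, so w sees only the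
noise. With Cauchy-Schwarz for the form (`norm_estForm_sq_le`) this puts the range of F(s) in S. For
a unit eigenfunction v with eigenvalue l, let w be its component orthogonal to S. Then l‖w‖² = B(w,
v) ≤ (q(w) l)^{1/2} and q(w) ≤ t²K‖w‖², so ‖w‖² ≤ K t²/l. A finite-dimensional invariant S would
contain an eigenvector f of the unit shift; |f|² would then be 1-periodic and integrable, so f = 0.
Hence S = 0, which settles all the finite-dimensional claims.

Noise floor. (C2) on the diagonal gives E[q_n(u)] = σ²⟨u, N u⟩. For the affine group the Fourier
transform turns the coefficient, as a function of b, into the transform of a product. Plancherel in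
b and the substitution η = aξ give q_ψ(φ) = ∫|ω|⁻¹|ψ̂|² · ‖φ‖² when both spectra lie on one
half-line (`energy_affine_eq`); polarizing twice gives the Duflo-Moore relations. Self-adjointness
of C_ρ holds for every real measurable multiplier (`isSelfAdjoint_fourierMultiplier`). -/

lemma coeFn_atomOp (a : Set.Ioi (0 : ℝ)) (b ν : ℝ) (x : Waveform) :
    (atomOp a b ν x : ℝ → ℂ) =ᵐ[volume] atomFun a b ν x :=
  MemLp.coeFn_toLp (memLp_atomFun a.2 b ν x)

/-- The inner product is an integral over t of a function jointly measurable in the parameters and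
t. One parametrized version serves the three groups. -/
lemma stronglyMeasurable_inner_atomOp {α : Type*} [MeasurableSpace α] {a : α → Set.Ioi (0 : ℝ)}
    {b ν : α → ℝ} (ha : Measurable a) (hb : Measurable b) (hν : Measurable ν) (x u : Waveform) :
    StronglyMeasurable fun i => inner ℂ (atomOp (a i) (b i) (ν i) x) u := by
  have h : (fun i => inner ℂ (atomOp (a i) (b i) (ν i) x) u)
      = fun i => ∫ t, inner ℂ (atomFun (a i) (b i) (ν i) x t) (u t) := by
    funext i
    rw [L2.inner_def]
    refine integral_congr_ae ?_
    filter_upwards [coeFn_atomOp (a i) (b i) (ν i) x] with t ht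
    rw [ht]
  rw [h]
  have ha' : Measurable fun p : α × ℝ => ((a p.1 : Set.Ioi (0 : ℝ)) : ℝ) :=
    measurable_subtype_coe.comp (ha.comp measurable_fst)
  have hb' : Measurable fun p : α × ℝ => b p.1 := hb.comp measurable_fst
  have hν' : Measurable fun p : α × ℝ => ν p.1 := hν.comp measurable_fst
  have hx : Measurable (x : ℝ → ℂ) := (Lp.stronglyMeasurable x).measurable
  have hu : Measurable (u : ℝ → ℂ) := (Lp.stronglyMeasurable u).measurable
  have hxt : Measurable fun p : α × ℝ => x ((p.2 - b p.1) / a p.1) :=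
    hx.comp ((measurable_snd.sub hb').div ha')
  have hm : Measurable fun p : α × ℝ =>
      inner ℂ (atomFun (a p.1) (b p.1) (ν p.1) x p.2) (u p.2) := by
    refine Measurable.inner ?_ (hu.comp measurable_snd)
    unfold atomFun
    refine (Measurable.mul ?_ ?_).mul hxt
    · exact Complex.measurable_ofReal.comp (ha'.pow_const _)
    · refine Complex.measurable_exp.comp ?_
      exact (measurable_const.mul (Complex.measurable_ofReal.comp hν')).mul
        (Complex.measurable_ofReal.comp measurable_snd)
  exact hm.stronglyMeasurable.integral_prod_right

lemma stronglyMeasurable_inner_rep (G : WaveformGroup) (x u : Waveform) :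
    StronglyMeasurable fun g => inner ℂ (G.rep g x) u := by
  cases G with
  | translation =>
    exact stronglyMeasurable_inner_atomOp (α := ℝ) measurable_const measurable_neg
      measurable_const x u
  | affine =>
    exact stronglyMeasurable_inner_atomOp (α := Set.Ioi (0 : ℝ) × ℝ) measurable_fst
      measurable_snd measurable_const x u
  | timeFrequency =>
    exact stronglyMeasurable_inner_atomOp (α := ℝ × ℝ) measurable_const measurable_fst
      measurable_snd x u

/-- Carathéodory functions, continuous in one variable and measurable in the other, are jointly
measurable over a second countable metrizable space. -/
lemma stronglyMeasurable_comp_of_continuous {E α Ω : Type*} [TopologicalSpace E]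
    [TopologicalSpace.MetrizableSpace E] [SecondCountableTopology E] [MeasurableSpace α]
    [MeasurableSpace Ω] {f : E → α → ℂ} (hc : ∀ a, Continuous fun x => f x a)
    (hm : ∀ x, StronglyMeasurable (f x)) {n : Ω → E} (hn : StronglyMeasurable n) :
    StronglyMeasurable fun p : Ω × α => f (n p.1) p.2 := by
  borelize E
  exact (stronglyMeasurable_uncurry_of_continuous_of_stronglyMeasurable hc hm).comp_measurable
    ((hn.measurable.comp measurable_fst).prodMk measurable_snd)

lemma stronglyMeasurable_uncurry_inner_rep (G : WaveformGroup) {Ω : Type*} [MeasurableSpace Ω]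
    {n : Ω → Waveform} (hn : StronglyMeasurable n) (u : Waveform) :
    StronglyMeasurable fun p : Ω × G.Elt => inner ℂ (G.rep p.2 (n p.1)) u := by
  -- A finite exponent makes the waveform space separable, hence second countable.
  have : Fact ((2 : ℝ≥0∞) ≠ ∞) := ⟨by simp⟩
  have h : ∀ g : G.Elt, Continuous fun x => inner ℂ (G.rep g x) u := fun g =>
    (G.rep g).continuous.inner continuous_const
  exact stronglyMeasurable_comp_of_continuous (f := fun x (g : G.Elt) => inner ℂ (G.rep g x) u)
    h (fun x => stronglyMeasurable_inner_rep G x u) hn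

instance instSigmaFiniteComapIoi :
    SigmaFinite (Measure.comap (Subtype.val : Set.Ioi (0 : ℝ) → ℝ) volume) := by
  refine SigmaFinite.of_map _ measurable_subtype_coe.aemeasurable ?_
  rw [(MeasurableEmbedding.subtype_coe measurableSet_Ioi).map_comap]
  infer_instance

instance instSFiniteHaar (G : WaveformGroup) : SFinite G.haar := by
  cases G with
  | translation => exact inferInstanceAs (SFinite (volume : Measure ℝ))
  | affine =>
    exact inferInstanceAs (SFinite
      (((Measure.comap Subtype.val (volume : Measure ℝ)).prod (volume : Measure ℝ)).withDensity
        fun g : Set.Ioi (0 : ℝ) × ℝ => ENNReal.ofReal (((g.1 : ℝ) ^ 2)⁻¹)))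
  | timeFrequency => exact inferInstanceAs (SFinite (volume : Measure (ℝ × ℝ)))

section

variable (G : WaveformGroup)

lemma eLpNorm_two_sq {α : Type*} [MeasurableSpace α] {μ : Measure α} (f : α → ℂ) :
    eLpNorm f 2 μ ^ 2 = ∫⁻ a, ‖f a‖ₑ ^ 2 ∂μ := by
  have h := eLpNorm_nnreal_pow_eq_lintegral (f := f) (μ := μ) (p := 2) two_ne_zero
  simpa using h

lemma memLp_two_iff_lintegral {α : Type*} [MeasurableSpace α] {μ : Measure α} {f : α → ℂ}
    (hf : AEStronglyMeasurable f μ) : MemLp f 2 μ ↔ ∫⁻ a, ‖f a‖ₑ ^ 2 ∂μ < ∞ := by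
  rw [← eLpNorm_two_sq, MemLp, and_iff_right hf]
  simp [lt_top_iff_ne_top]

lemma mem_formDomain_iff {x u : Waveform} : u ∈ formDomain G x ↔ energy G x u < ∞ :=
  memLp_two_iff_lintegral (stronglyMeasurable_inner_rep G x u).aestronglyMeasurable

/-- No finiteness is needed: at infinite energy the Bochner integral and `toReal` both take the
value 0. -/
lemma estForm_self (x u : Waveform) : estForm G x u u = ((energy G x u).toReal : ℂ) := by
  have h : ∀ g : G.Elt, inner ℂ u (G.rep g x) * inner ℂ (G.rep g x) u
      = (((‖inner ℂ (G.rep g x) u‖ₑ ^ 2).toReal : ℝ) : ℂ) := fun g => by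
    rw [← inner_conj_symm, RCLike.conj_mul]
    simp
  unfold estForm energy
  simp_rw [h]
  rw [integral_complex_ofReal, integral_toReal]
  · exact ((stronglyMeasurable_inner_rep G x u).measurable.enorm.pow_const 2).aemeasurable
  · exact Eventually.of_forall fun g => by simp

lemma energy_self_of_mem_estGraph {x u w : Waveform} (h : (u, w) ∈ estGraph G x) :
    ((energy G x u).toReal : ℂ) = inner ℂ u w := by
  rw [← estForm_self]; exact h.2.2 u h.1

/-- Cauchy-Schwarz in L² of the group; it drives both the range statement and subspace separation.
-/
lemma norm_estForm_sq_le {x u v : Waveform} (hu : u ∈ formDomain G x) (hv : v ∈ formDomain G x) :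
    ‖estForm G x v u‖ ^ 2 ≤ (energy G x v).toReal * (energy G x u).toReal := by
  have hu' := (mem_formDomain_iff G).1 hu
  have hv' := (mem_formDomain_iff G).1 hv
  have h1 : ‖estForm G x v u‖ₑ ≤ ∫⁻ g, ‖inner ℂ (G.rep g x) v‖ₑ * ‖inner ℂ (G.rep g x) u‖ₑ ∂G.haar := by
    refine (enorm_integral_le_lintegral_enorm _).trans (lintegral_mono fun g => ?_)
    rw [enorm_mul, ← inner_conj_symm, RCLike.enorm_conj]
  have h2 := ENNReal.lintegral_mul_le_Lp_mul_Lq G.haar Real.HolderConjugate.two_two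
    ((stronglyMeasurable_inner_rep G x v).measurable.enorm.aemeasurable)
    ((stronglyMeasurable_inner_rep G x u).measurable.enorm.aemeasurable)
  have h3 : ‖estForm G x v u‖ₑ ^ 2 ≤ energy G x v * energy G x u := by
    calc _ ≤ (energy G x v ^ (1 / 2 : ℝ) * energy G x u ^ (1 / 2 : ℝ)) ^ 2 := by
          gcongr
          refine h1.trans (h2.trans_eq ?_)
          simp [energy]
      _ = _ := by
          rw [mul_pow, ← ENNReal.rpow_natCast, ← ENNReal.rpow_natCast, ← ENNReal.rpow_mul,
            ← ENNReal.rpow_mul]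
          norm_num
  have h4 := ENNReal.toReal_mono (ENNReal.mul_lt_top hv' hu').ne h3
  simpa using h4

lemma estimator_graph (x : Waveform) : (estimator G x).graph = estGraph G x :=
  Submodule.toLinearPMap_graph_eq _ (estGraph_functional G x)

end

/-! ### The mean of the estimator -/

lemma lintegral_enorm_const_add_sq {Ω : Type*} [MeasurableSpace Ω] {P : Measure Ω}
    [IsProbabilityMeasure P] {Y : Ω → ℂ} (hY : Integrable Y P) (h0 : ∫ ω, Y ω ∂P = 0) (c : ℂ) :
    ∫⁻ ω, ‖c + Y ω‖ₑ ^ 2 ∂P = ‖c‖ₑ ^ 2 + ∫⁻ ω, ‖Y ω‖ₑ ^ 2 ∂P := by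
  have hm := hY.aestronglyMeasurable
  have hcm : AEStronglyMeasurable (fun ω => c + Y ω) P := aestronglyMeasurable_const.add hm
  have hc : MemLp (fun _ : Ω => c) 2 P := memLp_const c
  by_cases h : MemLp Y 2 P
  · have hcY : MemLp (fun ω => c + Y ω) 2 P := hc.add h
    have key : ∫ ω, ‖c + Y ω‖ ^ 2 ∂P = ‖c‖ ^ 2 + ∫ ω, ‖Y ω‖ ^ 2 ∂P := by
      have e : ∀ ω, ‖c + Y ω‖ ^ 2 = (‖c‖ ^ 2 + 2 * (inner ℂ c (Y ω)).re) + ‖Y ω‖ ^ 2 :=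
        fun ω => norm_add_sq (𝕜 := ℂ) c (Y ω)
      have hi : Integrable (fun ω => inner ℂ c (Y ω)) P := hY.const_inner c
      have hi' : Integrable (fun ω => (inner ℂ c (Y ω)).re) P := hi.re
      have hz : ∫ ω, (inner ℂ c (Y ω)).re ∂P = 0 := by
        have h1 := integral_re hi
        have h2 : ∫ ω, inner ℂ c (Y ω) ∂P = 0 := by rw [integral_inner hY, h0, inner_zero_right]
        rw [h2] at h1
        simpa using h1
      have hs : Integrable (fun ω => ‖c‖ ^ 2 + 2 * (inner ℂ c (Y ω)).re) P :=
        (integrable_const _).add (hi'.const_mul 2)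
      simp_rw [e]
      rw [integral_add hs h.integrable_norm_pow',
        integral_add (integrable_const _) (hi'.const_mul 2), integral_const_mul, hz]
      simp
    have conv : ∀ {Z : Ω → ℂ}, MemLp Z 2 P →
        ∫⁻ ω, ‖Z ω‖ₑ ^ 2 ∂P = ENNReal.ofReal (∫ ω, ‖Z ω‖ ^ 2 ∂P) := fun {Z} hZ => by
      rw [ofReal_integral_eq_lintegral_ofReal hZ.integrable_norm_pow'
        (Eventually.of_forall fun ω => by positivity)]
      refine lintegral_congr fun ω => ?_
      rw [ENNReal.ofReal_pow (norm_nonneg _), ofReal_norm]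
    rw [conv hcY, conv h, key, ENNReal.ofReal_add (by positivity)
      (integral_nonneg fun ω => by positivity), ENNReal.ofReal_pow (norm_nonneg _), ofReal_norm]
  -- Constants are square-integrable for a probability measure, so Y and c + Y leave L² together and
  -- both sides are ∞.
  · have h1 : ¬ MemLp (fun ω => c + Y ω) 2 P := fun h' => h <| by
      refine (h'.sub hc).ae_eq (Eventually.of_forall fun ω => ?_)
      simp
    rw [memLp_two_iff_lintegral hm, not_lt, top_le_iff] at h
    rw [memLp_two_iff_lintegral hcm, not_lt, top_le_iff] at h1
    rw [h, h1, add_top]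

section

variable (G : WaveformGroup) {Ω : Type*} [MeasurableSpace Ω] {P : Measure Ω}

lemma lintegral_energy_eq_prod [SFinite P] {n : Ω → Waveform} (hn : StronglyMeasurable n)
    (u : Waveform) : ∫⁻ ω, energy G (n ω) u ∂P
      = ∫⁻ p : Ω × G.Elt, ‖inner ℂ (G.rep p.2 (n p.1)) u‖ₑ ^ 2 ∂(P.prod G.haar) :=
  (lintegral_prod (fun p : Ω × G.Elt => ‖inner ℂ (G.rep p.2 (n p.1)) u‖ₑ ^ 2)
    ((stronglyMeasurable_uncurry_inner_rep G hn u).measurable.enorm.pow_const 2).aemeasurable).symm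

lemma measurable_energy {n : Ω → Waveform} (hn : StronglyMeasurable n)
    (u : Waveform) : Measurable fun ω => energy G (n ω) u :=
  ((stronglyMeasurable_uncurry_inner_rep G hn u).measurable.enorm.pow_const 2).lintegral_prod_right'

lemma aemeasurable_energy {n : Ω → Waveform} (hn : AEStronglyMeasurable n P)
    (u : Waveform) : AEMeasurable (fun ω => energy G (n ω) u) P :=
  ⟨_, measurable_energy G hn.stronglyMeasurable_mk u, by
    filter_upwards [hn.ae_eq_mk] with ω h; rw [h]⟩

/-- The adjoint of ρ(g) moves to u, where the weak mean-zero hypothesis applies; the conjugation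
comes from n standing in the antilinear slot. -/
lemma inner_rep_mean_zero {n : Ω → Waveform}
    (hn : ∀ u : Waveform, Integrable (fun ω => inner ℂ u (n ω)) P ∧ ∫ ω, inner ℂ u (n ω) ∂P = 0)
    (g : G.Elt) (u : Waveform) : Integrable (fun ω => inner ℂ (G.rep g (n ω)) u) P ∧
      ∫ ω, inner ℂ (G.rep g (n ω)) u ∂P = 0 := by
  have h : ∀ ω, inner ℂ (G.rep g (n ω)) u
      = starRingEnd ℂ (inner ℂ ((G.rep g).toContinuousLinearMap.adjoint u) (n ω)) := fun ω => by
    rw [inner_conj_symm, ContinuousLinearMap.adjoint_inner_right]; rfl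
  simp_rw [h]
  obtain ⟨h1, h2⟩ := hn ((G.rep g).toContinuousLinearMap.adjoint u)
  refine ⟨(LinearIsometryEquiv.integrable_comp_iff Complex.conjLIE).2 h1, ?_⟩
  rw [integral_conj, h2, map_zero]

lemma lintegral_energy_add [IsProbabilityMeasure P] (s : Waveform) {n : Ω → Waveform}
    (hm : AEStronglyMeasurable n P)
    (hn : ∀ u : Waveform, Integrable (fun ω => inner ℂ u (n ω)) P ∧ ∫ ω, inner ℂ u (n ω) ∂P = 0)
    (u : Waveform) :
    ∫⁻ ω, energy G (s + n ω) u ∂P = energy G s u + ∫⁻ ω, energy G (n ω) u ∂P := by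
  have hae := hm.ae_eq_mk
  -- Joint measurability on Ω × G requires a strongly measurable representative of the noise.
  set m := hm.mk n with hmdef
  have hms : StronglyMeasurable m := hm.stronglyMeasurable_mk
  have hn' : ∀ u : Waveform, Integrable (fun ω => inner ℂ u (m ω)) P ∧
      ∫ ω, inner ℂ u (m ω) ∂P = 0 := fun u => by
    have e : (fun ω => inner ℂ u (n ω)) =ᵐ[P] fun ω => inner ℂ u (m ω) := by
      filter_upwards [hae] with ω h; rw [h]
    exact ⟨(hn u).1.congr e, by rw [← integral_congr_ae e, (hn u).2]⟩
  have e1 : ∫⁻ ω, energy G (s + n ω) u ∂P = ∫⁻ ω, energy G (s + m ω) u ∂P :=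
    lintegral_congr_ae (by filter_upwards [hae] with ω h; rw [h])
  have e2 : ∫⁻ ω, energy G (n ω) u ∂P = ∫⁻ ω, energy G (m ω) u ∂P :=
    lintegral_congr_ae (by filter_upwards [hae] with ω h; rw [h])
  have hsm : StronglyMeasurable fun ω => s + m ω := stronglyMeasurable_const.add hms
  rw [e1, e2]
  unfold energy
  rw [lintegral_lintegral_swap (f := fun ω g => ‖inner ℂ (G.rep g (s + m ω)) u‖ₑ ^ 2)
      ((stronglyMeasurable_uncurry_inner_rep G hsm u).measurable.enorm.pow_const 2).aemeasurable,
    lintegral_lintegral_swap (f := fun ω g => ‖inner ℂ (G.rep g (m ω)) u‖ₑ ^ 2)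
      ((stronglyMeasurable_uncurry_inner_rep G hms u).measurable.enorm.pow_const 2).aemeasurable,
    ← lintegral_add_left
      ((stronglyMeasurable_inner_rep G s u).measurable.enorm.pow_const 2)]
  refine lintegral_congr fun g => ?_
  obtain ⟨h1, h2⟩ := inner_rep_mean_zero G hn' g u
  simp_rw [map_add, inner_add_left]
  exact lintegral_enorm_const_add_sq h1 h2 _

lemma memLp_prod_inner_rep [SFinite P] {n : Ω → Waveform} (hn : StronglyMeasurable n)
    {u : Waveform} (h : ∫⁻ ω, energy G (n ω) u ∂P < ∞) :
    MemLp (fun p : Ω × G.Elt => inner ℂ (G.rep p.2 (n p.1)) u) 2 (P.prod G.haar) := by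
  rw [memLp_two_iff_lintegral (stronglyMeasurable_uncurry_inner_rep G hn u).aestronglyMeasurable,
    ← lintegral_energy_eq_prod G hn]
  exact h

lemma integrable_inner_mul_inner {α : Type*} [MeasurableSpace α] {μ : Measure α}
    {x y : α → Waveform} {v u : Waveform} (hv : MemLp (fun a => inner ℂ (x a) v) 2 μ)
    (hu : MemLp (fun a => inner ℂ (y a) u) 2 μ) :
    Integrable (fun a => inner ℂ v (x a) * inner ℂ (y a) u) μ := by
  have hv' : MemLp (fun a => inner ℂ v (x a)) 2 μ := by
    refine hv.star.ae_eq (Eventually.of_forall fun g => ?_)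
    simp only [Pi.star_apply, RCLike.star_def, inner_conj_symm]
  exact hv'.integrable_mul hu

/-- The four finiteness hypotheses make each factor square-integrable on Ω × G, so Fubini allows the
expectation to be taken first, at fixed g, where it vanishes. -/
lemma crossForm_mean_zero [IsProbabilityMeasure P] (s : Waveform) {n : Ω → Waveform}
    (hm : AEStronglyMeasurable n P)
    (hn : ∀ u : Waveform, Integrable (fun ω => inner ℂ u (n ω)) P ∧ ∫ ω, inner ℂ u (n ω) ∂P = 0)
    {u v : Waveform} (hsu : energy G s u < ∞) (hsv : energy G s v < ∞)
    (hnu : ∫⁻ ω, energy G (n ω) u ∂P < ∞) (hnv : ∫⁻ ω, energy G (n ω) v ∂P < ∞) :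
    Integrable (fun ω => crossForm G s (n ω) v u) P ∧ ∫ ω, crossForm G s (n ω) v u ∂P = 0 := by
  have hae := hm.ae_eq_mk
  set m := hm.mk n with hmdef
  have hms : StronglyMeasurable m := hm.stronglyMeasurable_mk
  have e0 : (fun ω => crossForm G s (n ω) v u) =ᵐ[P] fun ω => crossForm G s (m ω) v u := by
    filter_upwards [hae] with ω h; rw [h]
  have e2 : ∀ u, ∫⁻ ω, energy G (n ω) u ∂P = ∫⁻ ω, energy G (m ω) u ∂P := fun u =>
    lintegral_congr_ae (by filter_upwards [hae] with ω h; rw [h])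
  have hn' : ∀ u : Waveform, Integrable (fun ω => inner ℂ u (m ω)) P ∧
      ∫ ω, inner ℂ u (m ω) ∂P = 0 := fun u => by
    have e : (fun ω => inner ℂ u (n ω)) =ᵐ[P] fun ω => inner ℂ u (m ω) := by
      filter_upwards [hae] with ω h; rw [h]
    exact ⟨(hn u).1.congr e, by rw [← integral_congr_ae e, (hn u).2]⟩
  rw [e2] at hnu hnv
  have hs' : ∀ u, energy G s u < ∞ → ∫⁻ _ : Ω, energy G s u ∂P < ∞ := fun u hu => by
    simpa using hu
  have hi : Integrable (fun p : Ω × G.Elt => inner ℂ v (G.rep p.2 s) * inner ℂ (G.rep p.2 (m p.1)) u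
      + inner ℂ v (G.rep p.2 (m p.1)) * inner ℂ (G.rep p.2 s) u) (P.prod G.haar) :=
    (integrable_inner_mul_inner (memLp_prod_inner_rep G stronglyMeasurable_const (hs' v hsv))
      (memLp_prod_inner_rep G hms hnu)).add
    (integrable_inner_mul_inner (memLp_prod_inner_rep G hms hnv)
      (memLp_prod_inner_rep G stronglyMeasurable_const (hs' u hsu)))
  refine ⟨hi.integral_prod_left.congr e0.symm, ?_⟩
  rw [integral_congr_ae e0]
  unfold crossForm
  rw [integral_integral_swap hi]
  refine integral_eq_zero_of_ae (Eventually.of_forall fun g => ?_)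
  obtain ⟨h1, h2⟩ := inner_rep_mean_zero G hn' g u
  obtain ⟨h3, h4⟩ := inner_rep_mean_zero G hn' g v
  have h5 : (fun ω => inner ℂ v (G.rep g (m ω)))
      = fun ω => starRingEnd ℂ (inner ℂ (G.rep g (m ω)) v) := by
    funext ω; rw [inner_conj_symm]
  have h6 : Integrable (fun ω => inner ℂ v (G.rep g (m ω))) P := by
    rw [h5]; exact (LinearIsometryEquiv.integrable_comp_iff Complex.conjLIE).2 h3
  have h7 : ∫ ω, inner ℂ v (G.rep g (m ω)) ∂P = 0 := by
    rw [h5, integral_conj, h4, map_zero]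
  simp only [Pi.zero_apply]
  rw [integral_add (h1.const_mul _) (h6.mul_const _), integral_const_mul, integral_mul_const, h2,
    h7]
  simp

lemma estForm_add {s x u v : Waveform} (hsu : u ∈ formDomain G s) (hsv : v ∈ formDomain G s)
    (hxu : u ∈ formDomain G x) (hxv : v ∈ formDomain G x) :
    estForm G (s + x) v u = estForm G s v u + crossForm G s x v u + estForm G x v u := by
  have h1 := integrable_estForm G hsu hsv
  have h2 := integrable_estForm G hxu hxv
  have h3 : Integrable (fun g => inner ℂ v (G.rep g s) * inner ℂ (G.rep g x) u
      + inner ℂ v (G.rep g x) * inner ℂ (G.rep g s) u) G.haar :=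
    (integrable_inner_mul_inner hsv hxu).add (integrable_inner_mul_inner hxv hsu)
  have h4 : Integrable (fun g => inner ℂ v (G.rep g s) * inner ℂ (G.rep g s) u
      + (inner ℂ v (G.rep g s) * inner ℂ (G.rep g x) u
        + inner ℂ v (G.rep g x) * inner ℂ (G.rep g s) u)) G.haar := h1.add h3
  unfold estForm crossForm
  rw [← integral_add h1 h3, ← integral_add h4 h2]
  refine integral_congr_ae (Eventually.of_forall fun g => ?_)
  simp only [map_add, inner_add_left, inner_add_right]
  ring

lemma ae_mem_formDomain {n : Ω → Waveform} (hm : AEStronglyMeasurable n P) {u : Waveform}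
    (h : ∫⁻ ω, energy G (n ω) u ∂P < ∞) : ∀ᵐ ω ∂P, u ∈ formDomain G (n ω) := by
  filter_upwards [ae_lt_top' (aemeasurable_energy G hm u) h.ne] with ω hω
  exact (mem_formDomain_iff G).2 hω

lemma estimator_apply_mem (s : Waveform) (u : (estimator G s).domain) :
    ((u : Waveform), estimator G s u) ∈ estGraph G s := by
  rw [← estimator_graph]; exact LinearPMap.mem_graph _ u

lemma HasMeanEstimator.signal_add [IsProbabilityMeasure P] (s : Waveform) {n : Ω → Waveform}
    (hm : AEStronglyMeasurable n P)
    (hn : ∀ u : Waveform, Integrable (fun ω => inner ℂ u (n ω)) P ∧ ∫ ω, inner ℂ u (n ω) ∂P = 0)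
    {A : Waveform →ₗ.[ℂ] Waveform} (h : HasMeanEstimator G P n A) :
    HasMeanEstimator G P (fun ω => s + n ω) (estimator G s + A) := by
  have hdom : ∀ u : (estimator G s + A).domain, (u : Waveform) ∈ formDomain G s := fun u =>
    (estimator_apply_mem G s ⟨u, u.2.1⟩).1
  refine ⟨fun u => ?_, fun u v => ?_⟩
  · rw [lintegral_energy_add G s hm hn]
    exact ENNReal.add_lt_top.2 ⟨(mem_formDomain_iff G).1 (hdom u), h.1 ⟨u, u.2.2⟩⟩
  · have hsu := hdom u
    have hsv := hdom v
    have hnu := h.1 ⟨u, u.2.2⟩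
    have hnv := h.1 ⟨v, v.2.2⟩
    obtain ⟨c1, c2⟩ := crossForm_mean_zero G s hm hn ((mem_formDomain_iff G).1 hsu)
      ((mem_formDomain_iff G).1 hsv) hnu hnv
    obtain ⟨b1, b2⟩ := h.2 ⟨u, u.2.2⟩ ⟨v, v.2.2⟩
    -- The splitting is only almost sure: finite mean energy puts u and v in the form domain of n
    -- for almost every ω.
    have e : (fun ω => estForm G (s + n ω) v u) =ᵐ[P]
        fun ω => estForm G s v u + crossForm G s (n ω) v u + estForm G (n ω) v u := by
      filter_upwards [ae_mem_formDomain G hm hnu, ae_mem_formDomain G hm hnv] with ω h1 h2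
      exact estForm_add G hsu hsv h1 h2
    have c3 : Integrable (fun ω => estForm G s v u + crossForm G s (n ω) v u) P :=
      (integrable_const _).add c1
    refine ⟨(c3.add b1).congr e.symm, ?_⟩
    rw [integral_congr_ae e, integral_add c3 b1,
      integral_add (integrable_const _) c1, c2, b2, LinearPMap.add_apply, inner_add_right]
    have h3 := (estimator_apply_mem G s ⟨u, u.2.1⟩).2.2 v hsv
    simp only [integral_const, probReal_univ, one_smul, add_zero]
    rw [h3]

lemma HasMeanEstimator.lintegral_energy [IsProbabilityMeasure P] {n : Ω → Waveform}
    (hm : AEStronglyMeasurable n P) {A : Waveform →ₗ.[ℂ] Waveform}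
    (h : HasMeanEstimator G P n A) (u : A.domain) :
    ((∫⁻ ω, energy G (n ω) u ∂P).toReal : ℂ) = inner ℂ (u : Waveform) (A u) := by
  rw [← (h.2 u u).2]
  simp_rw [estForm_self]
  rw [integral_complex_ofReal, integral_toReal (aemeasurable_energy G hm u)
    (ae_lt_top' (aemeasurable_energy G hm u) (h.1 u).ne)]

end

/-! ### Invariant signal subspaces -/

section

variable (G : WaveformGroup) {S : Submodule ℂ Waveform}

lemma energy_signal_add_of_mem_orthogonal (hS : ∀ g : G.Elt, ∀ f ∈ S, G.rep g f ∈ S)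
    {s : Waveform} (hs : s ∈ S) (x : Waveform) {w : Waveform} (hw : w ∈ Sᗮ) :
    energy G (s + x) w = energy G x w := by
  unfold energy
  refine lintegral_congr fun g => ?_
  rw [map_add, inner_add_left, (Submodule.mem_orthogonal _ _).1 hw _ (hS g s hs), zero_add]

lemma energy_zero_left (u : Waveform) : energy G 0 u = 0 := by simp [energy]

lemma energy_smul_left (c : ℂ) (x u : Waveform) :
    energy G (c • x) u = ‖c‖ₑ ^ 2 * energy G x u := by
  unfold energy
  rw [← lintegral_const_mul _ ((stronglyMeasurable_inner_rep G x u).measurable.enorm.pow_const 2)]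
  refine lintegral_congr fun g => ?_
  rw [map_smul, inner_smul_left, enorm_mul, mul_pow, RCLike.enorm_conj]

/-- The component w' of w orthogonal to S has zero energy. It is therefore a legitimate test vector,
and Cauchy-Schwarz gives ⟨w', w⟩ = 0, hence w' = 0. -/
lemma estGraph_snd_mem (hS_closed : IsClosed (S : Set Waveform))
    (hS : ∀ g : G.Elt, ∀ f ∈ S, G.rep g f ∈ S) {s u w : Waveform} (hs : s ∈ S)
    (h : (u, w) ∈ estGraph G s) : w ∈ S := by
  have : CompleteSpace S := hS_closed.completeSpace_coe
  have hw' : w - S.starProjection w ∈ Sᗮ := S.sub_starProjection_mem_orthogonal w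
  set w' := w - S.starProjection w with hdef
  have he : energy G s w' = 0 := by
    have := energy_signal_add_of_mem_orthogonal G hS hs 0 hw'
    rwa [add_zero, energy_zero_left] at this
  have hD : w' ∈ formDomain G s := (mem_formDomain_iff G).2 (by rw [he]; exact ENNReal.zero_lt_top)
  have h1 : estForm G s w' u = 0 := by
    have := norm_estForm_sq_le G h.1 hD
    rw [he, ENNReal.toReal_zero, zero_mul] at this
    exact norm_eq_zero.1 (pow_eq_zero_iff two_ne_zero |>.1 (le_antisymm this (sq_nonneg _)))
  have h2 : inner ℂ w' w = 0 := by rw [← h.2.2 w' hD, h1]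
  have h3 : inner ℂ w' w' = 0 := by
    conv_lhs => rw [hdef, inner_sub_right, ← hdef, h2]
    rw [(Submodule.mem_orthogonal' _ _).1 hw' _ (S.starProjection_apply_mem w), sub_zero]
  have h4 := inner_self_eq_zero.1 h3
  rw [sub_eq_zero.1 h4]
  exact S.starProjection_apply_mem w

lemma range_estimator_le (hS_closed : IsClosed (S : Set Waveform))
    (hS : ∀ g : G.Elt, ∀ f ∈ S, G.rep g f ∈ S) {s : Waveform} (hs : s ∈ S) :
    LinearMap.range (estimator G s).toFun ≤ S := by
  rintro _ ⟨u, rfl⟩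
  exact estGraph_snd_mem G hS_closed hS hs (estimator_apply_mem G s u)

/-- With w the part of v orthogonal to S, l‖w‖² = B(w, v), while q(v) = l and q(w) ≤ t²K‖w‖²;
Cauchy-Schwarz compares them. The maximum with 0 covers negative K, which `ENNReal.ofReal`
truncates. -/
lemma infDist_sq_mul_le_of_eigenfunction (hS_closed : IsClosed (S : Set Waveform))
    (hS : ∀ g : G.Elt, ∀ f ∈ S, G.rep g f ∈ S) {s : Waveform} (hs : s ∈ S) {x : Waveform} {K : ℝ}
    (hK : ∀ u : Waveform, energy G x u ≤ ENNReal.ofReal K * ‖u‖ₑ ^ 2) {t l : ℝ} (hl : 0 < l)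
    {v : Waveform} (hv1 : ‖v‖ = 1) (hv : IsEigenfunction (estimator G (s + (t : ℂ) • x)) l v) :
    Metric.infDist v (S : Set Waveform) ^ 2 ≤ max K 0 * (t ^ 2 / l) := by
  have : CompleteSpace S := hS_closed.completeSpace_coe
  have hw : v - S.starProjection v ∈ Sᗮ := S.sub_starProjection_mem_orthogonal v
  set w := v - S.starProjection v with hdef
  have hdist : Metric.infDist v (S : Set Waveform) ≤ ‖w‖ := by
    rw [hdef, ← dist_eq_norm]
    exact Metric.infDist_le_dist_of_mem (S.starProjection_apply_mem v)
  have hgr : (v, (l : ℂ) • v) ∈ estGraph G (s + (t : ℂ) • x) := by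
    rw [← estimator_graph]; exact hv.2
  have he : (energy G (s + (t : ℂ) • x) w) ≤ ENNReal.ofReal (t ^ 2 * max K 0 * ‖w‖ ^ 2) := by
    rw [energy_signal_add_of_mem_orthogonal G hS hs _ hw, energy_smul_left,
      ENNReal.ofReal_mul (by positivity), ENNReal.ofReal_mul (by positivity), mul_assoc]
    refine mul_le_mul' (le_of_eq ?_) ((hK w).trans (le_of_eq ?_))
    · rw [← ofReal_norm, ← ENNReal.ofReal_pow (norm_nonneg _)]
      simp
    · rw [ENNReal.ofReal_pow (norm_nonneg _), ofReal_norm, ENNReal.ofReal_max]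
      simp
  have hD : w ∈ formDomain G (s + (t : ℂ) • x) :=
    (mem_formDomain_iff G).2 (he.trans_lt ENNReal.ofReal_lt_top)
  have hwv : inner ℂ w v = ((‖w‖ ^ 2 : ℝ) : ℂ) := by
    have hsplit : v = w + S.starProjection v := by rw [hdef]; abel
    conv_lhs => rw [hsplit, inner_add_right,
      (Submodule.mem_orthogonal' _ _).1 hw _ (S.starProjection_apply_mem v), add_zero,
      inner_self_eq_norm_sq_to_K]
    push_cast; rfl
  have hform : estForm G (s + (t : ℂ) • x) w v = ((l * ‖w‖ ^ 2 : ℝ) : ℂ) := by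
    rw [hgr.2.2 w hD, inner_smul_right, hwv]; push_cast; ring
  have hq : (energy G (s + (t : ℂ) • x) v).toReal = l := by
    have h := energy_self_of_mem_estGraph G hgr
    rw [inner_smul_right, inner_self_eq_norm_sq_to_K, hv1] at h
    simpa using Complex.ofReal_injective (by simpa using h)
  have hq' : (energy G (s + (t : ℂ) • x) w).toReal ≤ t ^ 2 * max K 0 * ‖w‖ ^ 2 :=
    ENNReal.toReal_le_of_le_ofReal (by positivity) he
  have hcs := norm_estForm_sq_le G hgr.1 hD
  rw [hform, hq, Complex.norm_real, Real.norm_of_nonneg (by positivity)] at hcs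
  have hfin : ‖w‖ ^ 2 ≤ max K 0 * (t ^ 2 / l) := by
    have h1 : (l * ‖w‖ ^ 2) ^ 2 ≤ t ^ 2 * max K 0 * ‖w‖ ^ 2 * l :=
      hcs.trans (mul_le_mul_of_nonneg_right hq' hl.le)
    -- The bound follows on cancelling l‖w‖², which requires w ≠ 0.
    rcases (norm_nonneg w).eq_or_lt with h0 | h0
    · rw [← h0, zero_pow two_ne_zero]; positivity
    · have h2 : 0 < l * ‖w‖ ^ 2 := by positivity
      rw [mul_div_assoc', le_div_iff₀ hl]
      refine le_of_mul_le_mul_left ?_ h2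
      linarith [h1]
  exact (pow_le_pow_left₀ Metric.infDist_nonneg hdist 2).trans hfin

lemma tendsto_infDist_of_eigenfunction (hS_closed : IsClosed (S : Set Waveform))
    (hS : ∀ g : G.Elt, ∀ f ∈ S, G.rep g f ∈ S) {s : Waveform} (hs : s ∈ S) {x : Waveform} {K : ℝ}
    (hK : ∀ u : Waveform, energy G x u ≤ ENNReal.ofReal K * ‖u‖ₑ ^ 2) {t l : ℕ → ℝ}
    {v : ℕ → Waveform} (hl : ∀ k, 0 < l k)
    (ht : Tendsto (fun k => t k ^ 2 / l k) atTop (𝓝 0))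
    (hv : ∀ k, ‖v k‖ = 1 ∧ IsEigenfunction (estimator G (s + (t k : ℂ) • x)) (l k) (v k)) :
    Tendsto (fun k => Metric.infDist (v k) (S : Set Waveform)) atTop (𝓝 0) := by
  have h1 : Tendsto (fun k => Metric.infDist (v k) (S : Set Waveform) ^ 2) atTop (𝓝 0) := by
    refine squeeze_zero (fun k => sq_nonneg _) (fun k =>
      infDist_sq_mul_le_of_eigenfunction G hS_closed hS hs hK (hl k) (hv k).1 (hv k).2) ?_
    simpa using ht.const_mul (max K 0)
  have h2 := (Real.continuous_sqrt.tendsto 0).comp h1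
  rw [Real.sqrt_zero] at h2
  refine h2.congr fun k => ?_
  exact Real.sqrt_sq Metric.infDist_nonneg

end

/-! ### Finite-dimensional invariant subspaces -/

/-- All three groups contain the unit time shift, so one argument excludes nonzero
finite-dimensional invariant subspaces for each. -/
lemma exists_rep_eq_shift (G : WaveformGroup) :
    ∃ g : G.Elt, G.rep g = atomOp ⟨1, Set.mem_Ioi.2 one_pos⟩ 1 0 := by
  cases G with
  | translation =>
    refine ⟨(-1 : ℝ), ?_⟩
    change atomOp _ (-(-1 : ℝ)) 0 = _
    rw [neg_neg]
  | affine =>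
    exact ⟨((⟨1, Set.mem_Ioi.2 one_pos⟩, 1) : Set.Ioi (0 : ℝ) × ℝ), rfl⟩
  | timeFrequency =>
    exact ⟨((1, 0) : ℝ × ℝ), rfl⟩

/-- Every unit interval carries the same mass, and an infinite sum of equal terms is 0 or ∞. -/
lemma lintegral_eq_zero_of_ae_periodic {F : ℝ → ℝ≥0∞}
    (hper : ∀ᵐ t, F (t - 1) = F t) (hfin : ∫⁻ t, F t ≠ ∞) : ∫⁻ t, F t = 0 := by
  set c : ℤ → ℝ≥0∞ := fun k => ∫⁻ t in Set.Ioc (k : ℝ) (k + 1), F t with hc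
  have hsum : ∫⁻ t, F t = ∑' k, c k := by
    rw [← setLIntegral_univ, ← iUnion_Ioc_intCast ℝ]
    exact lintegral_iUnion (fun k => measurableSet_Ioc) (Set.pairwise_disjoint_Ioc_intCast ℝ) _
  have hcp : Function.Periodic c 1 := fun k => by
    have h1 : ∫⁻ t in (fun t : ℝ => t - 1) ⁻¹' Set.Ioc (k : ℝ) (k + 1), F (t - 1)
        = ∫⁻ t in Set.Ioc (k : ℝ) (k + 1), F t :=
      (measurePreserving_sub_right volume (1 : ℝ)).setLIntegral_comp_preimage_emb
        (MeasurableEquiv.subRight (1 : ℝ)).measurableEmbedding F _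
    simp only [hc]
    rw [← h1, Set.preimage_sub_const_Ioc]
    push_cast
    exact lintegral_congr_ae (ae_restrict_of_ae (hper.mono fun t ht => ht.symm))
  have hconst : ∀ k, c k = c 0 := fun k => by simpa using hcp.int_mul_eq k
  by_contra h0
  refine hfin ?_
  rw [hsum] at h0 ⊢
  simp_rw [hconst] at h0 ⊢
  exact ENNReal.tsum_const_eq_top_of_ne_zero fun h => h0 (by simp [h])

/-- The shift is isometric, so |c| = 1 unless f = 0; then |f|² is periodic with finite integral. -/
lemma eq_zero_of_shift_eq_smul {f : Waveform} {c : ℂ}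
    (h : atomOp ⟨1, Set.mem_Ioi.2 one_pos⟩ 1 0 f = c • f) : f = 0 := by
  by_contra hf
  have hc : ‖c‖ = 1 := by
    have h1 := congrArg norm h
    rw [LinearIsometry.norm_map, norm_smul] at h1
    have := norm_pos_iff.2 hf
    field_simp at h1
    exact h1.symm
  have hper : ∀ᵐ t : ℝ, ‖f (t - 1)‖ₑ ^ 2 = ‖f t‖ₑ ^ 2 := by
    have h2 := coeFn_atomOp ⟨1, Set.mem_Ioi.2 one_pos⟩ 1 0 f
    rw [h] at h2
    filter_upwards [h2, Lp.coeFn_smul c f] with t h3 h4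
    rw [h4] at h3
    have h5 : f (t - 1) = c * f t := by
      simp [atomFun] at h3; exact h3.symm
    rw [h5, enorm_mul, ← ofReal_norm c, hc]
    simp
  have hlint : ∫⁻ t : ℝ, ‖f t‖ₑ ^ 2 = ‖f‖ₑ ^ 2 := by
    rw [← eLpNorm_two_sq, Lp.enorm_def]
  have h0 := lintegral_eq_zero_of_ae_periodic hper (by rw [hlint]; simp)
  rw [hlint] at h0
  exact hf (by simpa using h0)

/-- Over ℂ the shift restricted to a nonzero finite-dimensional S would have an eigenvector. -/
lemma eq_bot_of_finiteDimensional_of_invariant (G : WaveformGroup) {S : Submodule ℂ Waveform}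
    [FiniteDimensional ℂ S] (hS : ∀ g : G.Elt, ∀ f ∈ S, G.rep g f ∈ S) : S = ⊥ := by
  by_contra hne
  have : Nontrivial S := Submodule.nontrivial_iff_ne_bot.2 hne
  obtain ⟨g, hg⟩ := exists_rep_eq_shift G
  let T : Module.End ℂ S := (G.rep g).toLinearMap.restrict (hS g)
  obtain ⟨c, hc⟩ := Module.End.exists_eigenvalue T
  obtain ⟨f, hf⟩ := hc.exists_hasEigenvector
  refine hf.2 (Subtype.ext (eq_zero_of_shift_eq_smul (c := c) ?_))
  rw [← hg]
  exact congrArg Subtype.val hf.apply_eq_smul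

/-! ### The Fourier transform on `L¹` and on `L²` -/

lemma ae_eq_of_integral_schwartz_smul_eq {f g : ℝ → ℂ} (hf : LocallyIntegrable f)
    (hg : LocallyIntegrable g)
    (h : ∀ φ : SchwartzMap ℝ ℂ, ∫ x, φ x • f x = ∫ x, φ x • g x) : f =ᵐ[volume] g := by
  refine ae_eq_of_integral_contDiff_smul_eq hf hg fun φ hφ hc => ?_
  have hg₁ : HasCompactSupport (Complex.ofRealCLM ∘ φ) := hc.comp_left rfl
  have hg₂ : ContDiff ℝ (⊤ : ℕ∞) (Complex.ofRealCLM ∘ φ) := Complex.ofRealCLM.contDiff.comp hφ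
  simpa using h (hg₁.toSchwartzMap hg₂)

lemma integral_schwartz_smul_fourier {h : ℝ → ℂ} (hh : Integrable h) (φ : SchwartzMap ℝ ℂ) :
    ∫ x, φ x • (𝓕 h : ℝ → ℂ) x = ∫ x, (𝓕 φ : SchwartzMap ℝ ℂ) x • h x := by
  have := VectorFourier.integral_fourierIntegral_smul_eq_flip (L := innerₗ ℝ)
      Real.continuous_fourierChar continuous_inner (φ.integrable (μ := volume)) hh
  simp only [flip_innerₗ] at this
  exact this.symm

lemma integral_schwartz_smul_fourier_Lp (u : Waveform) (φ : SchwartzMap ℝ ℂ) :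
    ∫ x, φ x • (𝓕 u : Waveform) x = ∫ x, (𝓕 φ : SchwartzMap ℝ ℂ) x • u x := by
  have h := congrArg (fun T => T φ) (Lp.fourier_toTemperedDistribution_eq u)
  simp only [TemperedDistribution.fourier_apply, Lp.toTemperedDistribution_apply] at h
  exact h.symm

lemma continuous_fourier_of_integrable {h : ℝ → ℂ} (hh : Integrable h) :
    Continuous (𝓕 h : ℝ → ℂ) :=
  VectorFourier.fourierIntegral_continuous Real.continuous_fourierChar continuous_inner hh

/-- Both transforms move onto a Schwartz test function in the same way, so they agree as
distributions. -/
lemma fourier_toLp_ae_eq {h : ℝ → ℂ} (h1 : Integrable h) (h2 : MemLp h 2 volume) :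
    (𝓕 (h2.toLp h) : Waveform) =ᵐ[volume] (𝓕 h : ℝ → ℂ) := by
  refine ae_eq_of_integral_schwartz_smul_eq
    ((Lp.memLp _).locallyIntegrable one_le_two)
    (continuous_fourier_of_integrable h1).locallyIntegrable fun φ => ?_
  rw [integral_schwartz_smul_fourier h1, integral_schwartz_smul_fourier_Lp]
  refine integral_congr_ae ?_
  filter_upwards [h2.coeFn_toLp] with x hx
  rw [hx]

lemma lintegral_enorm_Lp_sq (u : Waveform) : ∫⁻ t : ℝ, ‖u t‖ₑ ^ 2 = ‖u‖ₑ ^ 2 := by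
  rw [← eLpNorm_two_sq, Lp.enorm_def]

/-- Plancherel's formula for integrable functions, with values in `[0, ∞]`. -/
lemma lintegral_enorm_fourier_sq {h : ℝ → ℂ} (h1 : Integrable h) :
    ∫⁻ ξ, ‖(𝓕 h : ℝ → ℂ) ξ‖ₑ ^ 2 = ∫⁻ x, ‖h x‖ₑ ^ 2 := by
  have hc := continuous_fourier_of_integrable h1
  by_cases h2 : MemLp h 2 volume
  · rw [← eLpNorm_two_sq, ← eLpNorm_two_sq, ← eLpNorm_congr_ae (fourier_toLp_ae_eq h1 h2),
      ← eLpNorm_congr_ae h2.coeFn_toLp, ← Lp.enorm_def, ← Lp.enorm_def, ← ofReal_norm,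
      ← ofReal_norm, Lp.norm_fourier_eq]
  -- If the transform were in L², its inverse L² transform would have the same Schwartz pairings as
  -- h, forcing h into L².
  · have h3 : ¬ MemLp (𝓕 h : ℝ → ℂ) 2 volume := fun h3 => h2 <| by
      set H : Waveform := 𝓕⁻ (h3.toLp _ : Waveform)
      have hH : (𝓕 H : Waveform) = h3.toLp _ := FourierTransform.fourier_fourierInv_eq _
      refine (Lp.memLp H).ae_eq ?_
      refine ae_eq_of_integral_schwartz_smul_eq
        ((Lp.memLp _).locallyIntegrable one_le_two) h1.locallyIntegrable fun φ => ?_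
      have hφ : φ = 𝓕 (𝓕⁻ φ : SchwartzMap ℝ ℂ) := (FourierTransform.fourier_fourierInv_eq φ).symm
      rw [hφ, ← integral_schwartz_smul_fourier h1, ← integral_schwartz_smul_fourier_Lp, hH]
      refine integral_congr_ae ?_
      filter_upwards [h3.coeFn_toLp] with x hx
      rw [hx]
    rw [memLp_two_iff_lintegral h1.aestronglyMeasurable, not_lt, top_le_iff] at h2
    rw [memLp_two_iff_lintegral hc.aestronglyMeasurable, not_lt, top_le_iff] at h3
    rw [h2, h3]

lemma fourier_atomFun {a : ℝ} (ha : 0 < a) (b : ℝ) (f : ℝ → ℂ) (ξ : ℝ) :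
    (𝓕 (atomFun a b 0 f) : ℝ → ℂ) ξ = atomFun a⁻¹ 0 (-b) (𝓕 f : ℝ → ℂ) ξ := by
  rw [Real.fourier_real_eq_integral_exp_smul]
  -- The integrand in the variable s = (t - b)/a, with the normalization and the phase e^{-2πibξ}
  -- pulled out.
  obtain ⟨g, hg⟩ : ∃ g : ℝ → ℂ, g = fun s : ℝ => (((a ^ (-(1 / 2) : ℝ) : ℝ) : ℂ)
      * Complex.exp (2 * Real.pi * Complex.I * ((-b : ℝ) : ℂ) * ξ))
      * (Complex.exp (((-2 * Real.pi * s * (a * ξ) : ℝ) : ℂ) * Complex.I) • f s) := ⟨_, rfl⟩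
  have h1 : ∀ t : ℝ, Complex.exp (((-2 * Real.pi * t * ξ : ℝ) : ℂ) * Complex.I) • atomFun a b 0 f t
      = g ((t - b) / a) :=
    fun t => by
      simp only [hg, atomFun, smul_eq_mul]
      have e : Complex.exp (((-2 * Real.pi * t * ξ : ℝ) : ℂ) * Complex.I)
          = Complex.exp (2 * Real.pi * Complex.I * ((-b : ℝ) : ℂ) * ξ)
            * Complex.exp (((-2 * Real.pi * ((t - b) / a) * (a * ξ) : ℝ) : ℂ) * Complex.I) := by
        rw [← Complex.exp_add]
        congr 1
        have ha' : (a : ℂ) ≠ 0 := by exact_mod_cast ha.ne'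
        push_cast
        field_simp
        ring
      rw [e]
      simp only [Complex.ofReal_zero, mul_zero, zero_mul, Complex.exp_zero]
      ring
  simp_rw [h1]
  rw [integral_sub_right_eq_self (fun t => g (t / a)) b, Measure.integral_comp_div, hg,
    integral_const_mul, abs_of_pos ha]
  have h2 : atomFun a⁻¹ 0 (-b) (𝓕 f : ℝ → ℂ) ξ = (((a⁻¹ ^ (-(1 / 2) : ℝ) : ℝ) : ℂ)
      * Complex.exp (2 * Real.pi * Complex.I * ((-b : ℝ) : ℂ) * ξ)) * (𝓕 f : ℝ → ℂ) (a * ξ) := by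
    simp only [atomFun]
    rw [sub_zero, div_inv_eq_mul, mul_comm ξ a]
  rw [h2, Real.fourier_real_eq_integral_exp_smul, Complex.real_smul, ← mul_assoc, ← mul_assoc,
    ← Complex.ofReal_mul]
  have h3 : a * a ^ (-(1 / 2) : ℝ) = a⁻¹ ^ (-(1 / 2) : ℝ) := by
    rw [Real.inv_rpow ha.le, Real.rpow_neg ha.le, inv_inv]
    nth_rewrite 1 [← Real.rpow_one a]
    rw [← Real.rpow_neg ha.le, ← Real.rpow_add ha]
    norm_num
  rw [h3]

lemma integrable_atomFun {a : ℝ} (ha : 0 < a) (b : ℝ) {f : ℝ → ℂ} (hf : Integrable f) :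
    Integrable (atomFun a b 0 f) := by
  have h : Integrable fun t => f ((t - b) / a) :=
    (hf.comp_div ha.ne').comp_sub_right b
  refine (h.const_mul ((a ^ (-(1 / 2) : ℝ) : ℝ) : ℂ)).congr (Eventually.of_forall fun t => ?_)
  simp [atomFun]

lemma atomFun_congr_ae {a : ℝ} (ha : 0 < a) (b ν : ℝ) {f g : ℝ → ℂ} (h : f =ᵐ[volume] g) :
    atomFun a b ν f =ᵐ[volume] atomFun a b ν g := by
  filter_upwards [ae_atom ha b h] with t ht
  simp only [atomFun, ht]

/-- Both sides are continuous in x, so Schwartz functions suffice, and there the integral formula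
applies. -/
lemma fourier_atomOp (a : Set.Ioi (0 : ℝ)) (b : ℝ) (x : Waveform) :
    (𝓕 (atomOp a b 0 x) : Waveform)
      = atomOp ⟨(a : ℝ)⁻¹, Set.mem_Ioi.2 (inv_pos.2 a.2)⟩ 0 (-b) (𝓕 x) := by
  have hc : Continuous fun x : Waveform => (𝓕 x : Waveform) :=
    (Lp.fourierTransformₗᵢ ℝ ℂ).continuous
  refine DenseRange.induction_on (SchwartzMap.denseRange_toLpCLM (E := ℝ) (F := ℂ) (p := 2)
    ENNReal.ofNat_ne_top) x ?_ fun f => ?_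
  · exact isClosed_eq (hc.comp (atomOp a b 0).continuous)
      ((atomOp ⟨(a : ℝ)⁻¹, Set.mem_Ioi.2 (inv_pos.2 a.2)⟩ 0 (-b)).continuous.comp hc)
  · have ha : (0 : ℝ) < a := a.2
    have hx : (SchwartzMap.toLpCLM ℝ (E := ℝ) ℂ 2 volume f : ℝ → ℂ) =ᵐ[volume] f :=
      f.coeFn_toLp 2 volume
    set x : Waveform := SchwartzMap.toLpCLM ℝ (E := ℝ) ℂ 2 volume f with hxdef
    have h1 : Integrable (atomFun a b 0 x) :=
      (integrable_atomFun ha b f.integrable).congr (atomFun_congr_ae ha b 0 hx).symm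
    have hF : (𝓕 x : Waveform) =ᵐ[volume] (𝓕 (x : ℝ → ℂ) : ℝ → ℂ) := by
      have := fourier_toLp_ae_eq (f.integrable.congr hx.symm) (Lp.memLp x)
      rwa [Lp.toLp_coeFn] at this
    refine Lp.ext ?_
    refine (fourier_toLp_ae_eq h1 (memLp_atomFun a.2 b 0 x)).trans ?_
    refine EventuallyEq.trans ?_ (coeFn_atomOp _ 0 (-b) _).symm
    refine EventuallyEq.trans (Eventually.of_forall fun ξ => fourier_atomFun ha b x ξ) ?_
    exact atomFun_congr_ae (inv_pos.2 ha) 0 (-b) hF.symm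

/-! ### Fourier multipliers -/

lemma exists_fourier_ae_eq {h : ℝ → ℂ} (hh : MemLp h 2 volume) :
    ∃ w : Waveform, (𝓕 w : Waveform) =ᵐ[volume] h := by
  refine ⟨𝓕⁻ (hh.toLp h : Waveform), ?_⟩
  rw [FourierTransform.fourier_fourierInv_eq]
  exact hh.coeFn_toLp

lemma eq_of_fourier_ae_eq {u w : Waveform}
    (h : (𝓕 u : Waveform) =ᵐ[volume] (𝓕 w : Waveform)) : u = w :=
  (Lp.fourierTransformₗᵢ ℝ ℂ).injective (Lp.ext h)

lemma fourier_zero_ae : (𝓕 (0 : Waveform) : Waveform) =ᵐ[volume] 0 := by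
  have h : (𝓕 (0 : Waveform) : Waveform) = 0 := (Lp.fourierTransformₗᵢ ℝ ℂ).map_zero
  rw [h]
  exact Lp.coeFn_zero ℂ 2 volume

lemma inner_eq_integral_fourier (u w : Waveform) :
    inner ℂ u w = ∫ ξ, inner ℂ ((𝓕 u : Waveform) ξ) ((𝓕 w : Waveform) ξ) := by
  rw [← Lp.inner_fourier_eq, L2.inner_def]

lemma mem_graph_fourierMultiplier {m : ℝ → ℝ} {u w : Waveform} :
    (u, w) ∈ (fourierMultiplier m).graph
      ↔ ∀ᵐ ξ : ℝ, (𝓕 w : Waveform) ξ = m ξ * (𝓕 u : Waveform) ξ := by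
  unfold fourierMultiplier
  rw [Submodule.toLinearPMap_graph_eq]
  · exact Iff.rfl
  · rintro ⟨p, q⟩ hp (rfl : p = 0)
    refine eq_of_fourier_ae_eq ?_
    filter_upwards [hp, fourier_zero_ae] with ξ h1 h2
    rw [h1, h2, Pi.zero_apply, mul_zero]

lemma fourier_fourierMultiplier_apply {m : ℝ → ℝ} (u : (fourierMultiplier m).domain) :
    ∀ᵐ ξ : ℝ, (𝓕 (fourierMultiplier m u) : Waveform) ξ = m ξ * (𝓕 (u : Waveform) : Waveform) ξ :=
  mem_graph_fourierMultiplier.1 (LinearPMap.mem_graph _ u)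

lemma mem_domain_fourierMultiplier_iff {m : ℝ → ℝ} {u : Waveform} :
    u ∈ (fourierMultiplier m).domain
      ↔ MemLp (fun ξ => (m ξ : ℂ) * (𝓕 u : Waveform) ξ) 2 volume := by
  rw [LinearPMap.mem_domain_iff]
  constructor
  · rintro ⟨w, hw⟩
    exact (Lp.memLp (𝓕 w : Waveform)).ae_eq (mem_graph_fourierMultiplier.1 hw)
  · intro h
    obtain ⟨w, hw⟩ := exists_fourier_ae_eq h
    exact ⟨w, mem_graph_fourierMultiplier.2 hw⟩

/-- Let d = ẑ - mŵ. Its truncation to {|m| ≤ N} is the transform of some u in the domain; testing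
with this u gives ‖u‖² = 0. Letting N grow gives d = 0. The case w = 0 yields density of the domain,
the general case that the adjoint is no larger than the operator. -/
lemma fourier_eq_mul_of_forall_inner_eq {m : ℝ → ℝ} (hm : Measurable m) {w z : Waveform}
    (h : ∀ u : (fourierMultiplier m).domain,
      inner ℂ z (u : Waveform) = inner ℂ w (fourierMultiplier m u)) :
    ∀ᵐ ξ : ℝ, (𝓕 z : Waveform) ξ = m ξ * (𝓕 w : Waveform) ξ := by
  set d : ℝ → ℂ := fun ξ => (𝓕 z : Waveform) ξ - m ξ * (𝓕 w : Waveform) ξ with hd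
  let E : ℕ → Set ℝ := fun N => {ξ | |m ξ| ≤ N}
  have hE : ∀ N, MeasurableSet (E N) := fun N => measurableSet_le hm.abs measurable_const
  have hbdd : ∀ (N : ℕ) {f : ℝ → ℂ}, AEStronglyMeasurable f volume →
      MemLp ((E N).indicator f) 2 volume →
      MemLp (fun ξ => (m ξ : ℂ) * (E N).indicator f ξ) 2 volume := fun N f hf hfL => by
    refine MemLp.of_le_mul (c := N) hfL ((Complex.measurable_ofReal.comp
      hm).aestronglyMeasurable.mul (hf.indicator (hE N))) (Eventually.of_forall fun ξ => ?_)
    by_cases hξ : ξ ∈ E N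
    · rw [norm_mul, Complex.norm_real, Real.norm_eq_abs]
      exact mul_le_mul_of_nonneg_right hξ (norm_nonneg _)
    · simp [Set.indicator_of_notMem hξ]
  have hz := Lp.memLp (𝓕 z : Waveform)
  have hw := Lp.memLp (𝓕 w : Waveform)
  have hdm : AEStronglyMeasurable d volume :=
    hz.1.sub ((Complex.measurable_ofReal.comp hm).aestronglyMeasurable.mul hw.1)
  have hdN : ∀ N, MemLp ((E N).indicator d) 2 volume := fun N => by
    refine ((hz.indicator (hE N)).sub (hbdd N hw.1 (hw.indicator (hE N)))).ae_eq
      (Eventually.of_forall fun ξ => ?_)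
    by_cases hξ : ξ ∈ E N
    · simp [hξ, hd]
    · simp [hξ]
  have hzero : ∀ N, (E N).indicator d =ᵐ[volume] 0 := fun N => by
    obtain ⟨u, hu⟩ := exists_fourier_ae_eq (hdN N)
    have hmem : u ∈ (fourierMultiplier m).domain := by
      rw [mem_domain_fourierMultiplier_iff]
      refine (hbdd N hdm (hdN N)).ae_eq ?_
      filter_upwards [hu] with ξ h1
      rw [h1]
    have h1 := h ⟨u, hmem⟩
    have h2 : inner ℂ u u = 0 := by
      rw [← sub_eq_zero.2 h1, inner_eq_integral_fourier, inner_eq_integral_fourier z,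
        inner_eq_integral_fourier w, ← integral_sub (L2.integrable_inner _ _)
          (L2.integrable_inner _ _)]
      refine integral_congr_ae ?_
      filter_upwards [hu, fourier_fourierMultiplier_apply ⟨u, hmem⟩] with ξ h3 h4
      rw [h4, h3]
      by_cases hξ : ξ ∈ E N
      · simp only [Set.indicator_of_mem hξ, hd, RCLike.inner_apply, map_sub, map_mul,
          Complex.conj_ofReal]
        ring
      · simp [Set.indicator_of_notMem hξ]
    rw [inner_self_eq_zero.1 h2] at hu
    exact hu.symm.trans fourier_zero_ae
  filter_upwards [ae_all_iff.2 hzero] with ξ hξ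
  obtain ⟨N, hN⟩ := exists_nat_ge |m ξ|
  have h3 := hξ N
  rw [Set.indicator_of_mem (show ξ ∈ E N from hN)] at h3
  exact sub_eq_zero.1 h3

lemma dense_domain_fourierMultiplier {m : ℝ → ℝ} (hm : Measurable m) :
    Dense ((fourierMultiplier m).domain : Set Waveform) := by
  rw [Submodule.dense_iff_topologicalClosure_eq_top, Submodule.topologicalClosure_eq_top_iff,
    Submodule.eq_bot_iff]
  intro z hz
  refine eq_of_fourier_ae_eq ?_
  have h := fourier_eq_mul_of_forall_inner_eq hm (w := 0) (z := z) fun u => by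
    rw [inner_zero_left]; exact (Submodule.mem_orthogonal' _ _).1 hz _ u.2
  filter_upwards [h, fourier_zero_ae] with ξ h1 h2
  rw [h1, h2, Pi.zero_apply, mul_zero]

lemma isSelfAdjoint_fourierMultiplier {m : ℝ → ℝ} (hm : Measurable m) :
    IsSelfAdjoint (fourierMultiplier m) := by
  have hdense := dense_domain_fourierMultiplier hm
  rw [LinearPMap.isSelfAdjoint_def]
  refine le_antisymm (LinearPMap.le_of_le_graph ?_) ?_
  · rintro ⟨w, z⟩ hwz
    obtain ⟨y, hy, hyz⟩ := (LinearPMap.mem_graph_iff _).1 hwz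
    subst hy
    change _ = z at hyz
    rw [mem_graph_fourierMultiplier, ← hyz]
    exact fourier_eq_mul_of_forall_inner_eq hm fun u =>
      LinearPMap.adjoint_isFormalAdjoint hdense y u
  · refine LinearPMap.IsFormalAdjoint.le_adjoint hdense fun u w => ?_
    rw [inner_eq_integral_fourier, inner_eq_integral_fourier (u : Waveform)]
    refine integral_congr_ae ?_
    filter_upwards [fourier_fourierMultiplier_apply u, fourier_fourierMultiplier_apply w]
      with ξ h1 h2
    rw [h1, h2]
    simp only [RCLike.inner_apply, map_mul, Complex.conj_ofReal]
    ring

lemma inner_fourierMultiplier_self {m : ℝ → ℝ} (hm : ∀ ξ, 0 ≤ m ξ)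
    (u : (fourierMultiplier m).domain) :
    ∫⁻ ξ : ℝ, ENNReal.ofReal (m ξ) * ‖(𝓕 (u : Waveform) : Waveform) ξ‖ₑ ^ 2 ≠ ∞ ∧
    inner ℂ (u : Waveform) (fourierMultiplier m u)
      = ((∫⁻ ξ : ℝ, ENNReal.ofReal (m ξ)
          * ‖(𝓕 (u : Waveform) : Waveform) ξ‖ₑ ^ 2).toReal : ℂ) := by
  have e : (fun ξ => inner ℂ ((𝓕 (u : Waveform) : Waveform) ξ)
      ((𝓕 (fourierMultiplier m u) : Waveform) ξ))
      =ᵐ[volume] fun ξ => ((m ξ * ‖(𝓕 (u : Waveform) : Waveform) ξ‖ ^ 2 : ℝ) : ℂ) := by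
    filter_upwards [fourier_fourierMultiplier_apply u] with ξ h1
    rw [h1, RCLike.inner_apply, mul_assoc, RCLike.mul_conj]
    push_cast; rfl
  have hi : Integrable (fun ξ => m ξ * ‖(𝓕 (u : Waveform) : Waveform) ξ‖ ^ 2) volume := by
    have := ((L2.integrable_inner (𝕜 := ℂ) (𝓕 (u : Waveform) : Waveform)
      (𝓕 (fourierMultiplier m u) : Waveform)).congr e).re
    exact this
  have hl : ∫⁻ ξ : ℝ, ENNReal.ofReal (m ξ) * ‖(𝓕 (u : Waveform) : Waveform) ξ‖ₑ ^ 2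
      = ENNReal.ofReal (∫ ξ, m ξ * ‖(𝓕 (u : Waveform) : Waveform) ξ‖ ^ 2) := by
    rw [ofReal_integral_eq_lintegral_ofReal hi
      (Eventually.of_forall fun ξ => mul_nonneg (hm ξ) (sq_nonneg _))]
    refine lintegral_congr fun ξ => ?_
    rw [ENNReal.ofReal_mul (hm ξ), ENNReal.ofReal_pow (norm_nonneg _), ofReal_norm]
  refine ⟨by rw [hl]; exact ENNReal.ofReal_ne_top, ?_⟩
  rw [hl, ENNReal.toReal_ofReal (integral_nonneg fun ξ => mul_nonneg (hm ξ) (sq_nonneg _)),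
    inner_eq_integral_fourier, integral_congr_ae e, integral_complex_ofReal]

lemma ae_ne_zero_real : ∀ᵐ ξ : ℝ, ξ ≠ 0 := by
  simp [ae_iff]

/-- Two factors |ξ|^{-1/2} invert |ξ| off the null set ξ = 0. The domains agree because the
intermediate vector, with transform |ξ|^{1/2} û, is in L² once û and |ξ| û are. -/
lemma inverseSquare_affineDufloMoore :
    inverseSquare affineDufloMoore = fourierMultiplier fun ξ => |ξ| := by
  refine congrArg Submodule.toLinearPMap (Submodule.ext ?_)
  rintro ⟨u, w⟩
  have hpow : ∀ ξ : ℝ, ξ ≠ 0 → |ξ| * (|ξ| ^ (-(1 / 2) : ℝ) * |ξ| ^ (-(1 / 2) : ℝ)) = 1 :=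
    fun ξ hξ => by
      have h0 := abs_pos.2 hξ
      rw [← Real.rpow_add h0]
      norm_num
      rw [Real.rpow_neg_one, mul_inv_cancel₀ h0.ne']
  change (∃ y : Waveform, (w, y) ∈ affineDufloMoore.graph ∧ (y, u) ∈ affineDufloMoore.graph) ↔
    ∀ᵐ ξ : ℝ, (𝓕 w : Waveform) ξ = ((|ξ| : ℝ) : ℂ) * (𝓕 u : Waveform) ξ
  simp only [affineDufloMoore, mem_graph_fourierMultiplier]
  constructor
  · rintro ⟨y, h1, h2⟩
    filter_upwards [h1, h2, ae_ne_zero_real] with ξ h3 h4 h5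
    rw [h4, h3, ← mul_assoc, ← mul_assoc, mul_assoc ((|ξ| : ℝ) : ℂ)]
    rw [← Complex.ofReal_mul, ← Complex.ofReal_mul, hpow ξ h5, Complex.ofReal_one, one_mul]
  · intro h
    have hm : AEStronglyMeasurable (fun ξ => ((|ξ| ^ (-(1 / 2) : ℝ) : ℝ) : ℂ)
        * (𝓕 w : Waveform) ξ) volume := by
      refine AEStronglyMeasurable.mul ?_ (Lp.aestronglyMeasurable _)
      exact (Complex.measurable_ofReal.comp
        (measurable_norm.pow_const (-(1 / 2) : ℝ))).aestronglyMeasurable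
    have hL : MemLp (fun ξ => ((|ξ| ^ (-(1 / 2) : ℝ) : ℝ) : ℂ) * (𝓕 w : Waveform) ξ) 2 volume := by
      have hsum := (Lp.memLp (𝓕 u : Waveform)).norm.add (Lp.memLp (𝓕 w : Waveform)).norm
      refine MemLp.mono hsum hm ?_
      filter_upwards [h, ae_ne_zero_real] with ξ h3 h5
      have h0 := abs_pos.2 h5
      have hp : 0 < |ξ| ^ (-(1 / 2) : ℝ) := by positivity
      -- The left side is p = |ξ|^{1/2}, and (p - 1)² ≥ 0 with p² = |ξ| gives 2p ≤ 1 + |ξ|.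
      have hq : |ξ| * |ξ| ^ (-(1 / 2) : ℝ) ≤ 1 + |ξ| := by
        have := hpow ξ h5
        nlinarith [sq_nonneg (|ξ| * |ξ| ^ (-(1 / 2) : ℝ) - 1)]
      simp only [Pi.add_apply]
      rw [Real.norm_of_nonneg (by positivity), h3, norm_mul, norm_mul, Complex.norm_real,
        Complex.norm_real, Real.norm_of_nonneg hp.le, Real.norm_of_nonneg h0.le, ← mul_assoc,
        mul_comm (|ξ| ^ (-(1 / 2) : ℝ)), ← one_add_mul]
      exact mul_le_mul_of_nonneg_right hq (norm_nonneg _)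
    obtain ⟨y, hy⟩ := exists_fourier_ae_eq hL
    refine ⟨y, hy, ?_⟩
    filter_upwards [h, hy, ae_ne_zero_real] with ξ h3 h4 h5
    rw [h4, h3, ← mul_assoc, ← mul_assoc, ← Complex.ofReal_mul, ← Complex.ofReal_mul,
      mul_comm (_ * _) |ξ|, hpow ξ h5, Complex.ofReal_one, one_mul]

lemma measurable_affineDufloMoore_symbol :
    Measurable fun ξ : ℝ => |ξ| ^ (-(1 / 2) : ℝ) :=
  measurable_norm.pow_const (-(1 / 2) : ℝ)

lemma affineDufloMoore_nonneg (ψ : affineDufloMoore.domain) :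
    0 ≤ (inner ℂ (ψ : Waveform) (affineDufloMoore ψ)).re := by
  have h := (inner_fourierMultiplier_self (fun ξ : ℝ => Real.rpow_nonneg (abs_nonneg ξ)
    (-(1 / 2) : ℝ)) ψ).2
  unfold affineDufloMoore
  rw [h, Complex.ofReal_re]
  exact ENNReal.toReal_nonneg

/-! ### The noise floor -/

lemma lintegral_energy_of_hasMeanEstimator_smul (G : WaveformGroup) {Ω : Type*}
    [MeasurableSpace Ω] {P : Measure Ω} [IsProbabilityMeasure P] {n : Ω → Waveform}
    (hm : AEStronglyMeasurable n P) {c : ℝ} (hc : 0 ≤ c) {N : Waveform →ₗ.[ℂ] Waveform}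
    (h : HasMeanEstimator G P n ((c : ℂ) • N)) (u : N.domain) {I : ℝ≥0∞} (hI : I ≠ ∞)
    (hN : inner ℂ (u : Waveform) (N u) = (I.toReal : ℂ)) :
    ∫⁻ ω, energy G (n ω) u ∂P = ENNReal.ofReal c * I := by
  have h1 := h.lintegral_energy G hm (u : ((c : ℂ) • N).domain)
  have h2 := h.1 (u : ((c : ℂ) • N).domain)
  rw [LinearPMap.smul_apply, inner_smul_right, hN, ← Complex.ofReal_mul] at h1
  have h3 := Complex.ofReal_injective h1
  rw [← ENNReal.ofReal_toReal h2.ne, h3, ENNReal.ofReal_mul hc, ENNReal.ofReal_toReal hI]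

/-! ### The Duflo-Moore relations of the affine group -/

/-- Translation by b is a modulation in frequency, and its phase is the Fourier kernel at -b. -/
lemma inner_atomOp_eq_fourier (a : Set.Ioi (0 : ℝ)) (b : ℝ) (ψ φ : Waveform) :
    inner ℂ (atomOp a b 0 ψ) φ
      = (𝓕 (fun ξ => inner ℂ (atomFun (a : ℝ)⁻¹ 0 0 (𝓕 ψ : Waveform) ξ)
          ((𝓕 φ : Waveform) ξ)) : ℝ → ℂ) (-b) := by
  rw [inner_eq_integral_fourier, fourier_atomOp, Real.fourier_real_eq_integral_exp_smul]
  refine integral_congr_ae ?_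
  filter_upwards [coeFn_atomOp ⟨(a : ℝ)⁻¹, Set.mem_Ioi.2 (inv_pos.2 a.2)⟩ 0 (-b)
    (𝓕 ψ : Waveform)] with ξ hξ
  rw [hξ]
  simp only [atomFun, RCLike.inner_apply, map_mul, smul_eq_mul, Complex.conj_ofReal,
    ← Complex.exp_conj, Complex.conj_I, Complex.ofReal_zero, mul_zero, zero_mul,
    Complex.exp_zero, mul_one, map_ofNat]
  rw [show 2 * (Real.pi : ℂ) * -Complex.I * ((-b : ℝ) : ℂ) * ξ
    = ((-2 * Real.pi * ξ * -b : ℝ) : ℂ) * Complex.I by push_cast; ring]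
  ring

/-- Plancherel in b. The product of the two transforms is integrable but need not be in L², hence
the use of Plancherel with values in [0, ∞]. -/
lemma lintegral_enorm_inner_atomOp_sq (a : Set.Ioi (0 : ℝ)) (ψ φ : Waveform) :
    ∫⁻ b : ℝ, ‖inner ℂ (atomOp a b 0 ψ) φ‖ₑ ^ 2
      = ∫⁻ ξ : ℝ, ENNReal.ofReal a * (‖(𝓕 ψ : Waveform) (a * ξ)‖ₑ ^ 2
          * ‖(𝓕 φ : Waveform) ξ‖ₑ ^ 2) := by
  have ha : (0 : ℝ) < a := a.2
  have hi : Integrable (fun ξ => inner ℂ (atomFun (a : ℝ)⁻¹ 0 0 (𝓕 ψ : Waveform) ξ)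
      ((𝓕 φ : Waveform) ξ)) := by
    refine (L2.integrable_inner (𝕜 := ℂ) (atomOp ⟨(a : ℝ)⁻¹, Set.mem_Ioi.2 (inv_pos.2 ha)⟩ 0 0
      (𝓕 ψ : Waveform)) (𝓕 φ : Waveform)).congr ?_
    filter_upwards [coeFn_atomOp ⟨(a : ℝ)⁻¹, Set.mem_Ioi.2 (inv_pos.2 ha)⟩ 0 0
      (𝓕 ψ : Waveform)] with ξ hξ
    rw [hξ]
  simp_rw [inner_atomOp_eq_fourier]
  rw [lintegral_neg_eq_self (fun b => ‖(𝓕 (fun ξ => inner ℂ (atomFun (a : ℝ)⁻¹ 0 0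
    (𝓕 ψ : Waveform) ξ) ((𝓕 φ : Waveform) ξ)) : ℝ → ℂ) b‖ₑ ^ 2),
    lintegral_enorm_fourier_sq hi]
  refine lintegral_congr fun ξ => ?_
  have h1 : ‖(((a : ℝ)⁻¹ ^ (-(1 / 2) : ℝ) : ℝ) : ℂ)‖ₑ ^ 2 = ENNReal.ofReal a := by
    rw [← ofReal_norm, ← ENNReal.ofReal_pow (norm_nonneg _), Complex.norm_real,
      Real.norm_of_nonneg (by positivity), Real.inv_rpow ha.le, Real.rpow_neg ha.le, inv_inv,
      ← Real.rpow_natCast, ← Real.rpow_mul ha.le]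
    norm_num
  simp only [atomFun, RCLike.inner_apply, map_mul, enorm_mul, mul_pow, RCLike.enorm_conj, h1,
    Complex.ofReal_zero, mul_zero, zero_mul, Complex.exp_zero, mul_one,
    sub_zero, div_inv_eq_mul, mul_comm ξ]
  ring

lemma lintegral_haar_affine {F : Set.Ioi (0 : ℝ) × ℝ → ℝ≥0∞} (hF : Measurable F) :
    ∫⁻ g, F g ∂WaveformGroup.affine.haar
      = ∫⁻ a, ENNReal.ofReal (((a : ℝ) ^ 2)⁻¹) * (∫⁻ b : ℝ, F (a, b))
          ∂(Measure.comap (Subtype.val : Set.Ioi (0 : ℝ) → ℝ) volume) := by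
  have hd : Measurable fun g : Set.Ioi (0 : ℝ) × ℝ => ENNReal.ofReal (((g.1 : ℝ) ^ 2)⁻¹) :=
    ENNReal.measurable_ofReal.comp
      ((measurable_subtype_coe.comp measurable_fst).pow_const 2).inv
  change ∫⁻ g, F g ∂(((Measure.comap Subtype.val (volume : Measure ℝ)).prod
      (volume : Measure ℝ)).withDensity fun g : Set.Ioi (0 : ℝ) × ℝ =>
        ENNReal.ofReal (((g.1 : ℝ) ^ 2)⁻¹)) = _
  rw [lintegral_withDensity_eq_lintegral_mul _ hd hF, lintegral_prod _ (hd.mul hF).aemeasurable]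
  refine lintegral_congr fun a => ?_
  simp only [Pi.mul_apply]
  have hFa : Measurable fun b : ℝ => F (a, b) := hF.comp measurable_prodMk_left
  exact lintegral_const_mul _ hFa

/-- `∫ |ω|⁻¹ |ψ̂(ω)|² dω`, the admissibility constant of `ψ`. -/
def admissibility (ψ : Waveform) : ℝ≥0∞ :=
  ∫⁻ ξ : ℝ, ENNReal.ofReal |ξ|⁻¹ * ‖(𝓕 ψ : Waveform) ξ‖ₑ ^ 2

/-- Substitute η = aξ: da/a is scale invariant, and η runs over the half-line containing ξ. -/
lemma setLIntegral_comp_mul_right_inv {f : ℝ → ℝ≥0∞} (hf : Measurable f) {ξ : ℝ} (hξ : ξ ≠ 0) :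
    ∫⁻ a in Set.Ioi 0, ENNReal.ofReal a⁻¹ * f (a * ξ)
      = ∫⁻ η in {η | 0 < η / ξ}, ENNReal.ofReal |η|⁻¹ * f η := by
  have hs : MeasurableSet {η : ℝ | 0 < η / ξ} :=
    measurableSet_lt measurable_const (measurable_id.div_const ξ)
  have hm : Measurable fun η : ℝ => ENNReal.ofReal |η|⁻¹ * f η :=
    (ENNReal.measurable_ofReal.comp measurable_norm.inv).mul hf
  have hH := hm.indicator hs
  have h1 : ∫⁻ a : ℝ, {η : ℝ | 0 < η / ξ}.indicator
        (fun η => ENNReal.ofReal |η|⁻¹ * f η) (a * ξ)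
      = ENNReal.ofReal |ξ⁻¹| * ∫⁻ η in {η | 0 < η / ξ}, ENNReal.ofReal |η|⁻¹ * f η := by
    rw [← lintegral_map hH (measurable_mul_const ξ), Real.map_volume_mul_right hξ,
      lintegral_smul_measure, lintegral_indicator hs, smul_eq_mul]
  have h2 : ∫⁻ a in Set.Ioi 0, ENNReal.ofReal a⁻¹ * f (a * ξ)
      = ENNReal.ofReal |ξ| * ∫⁻ a : ℝ, {η : ℝ | 0 < η / ξ}.indicator
        (fun η => ENNReal.ofReal |η|⁻¹ * f η) (a * ξ) := by
    have hHξ : Measurable fun a : ℝ => {η : ℝ | 0 < η / ξ}.indicator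
        (fun η => ENNReal.ofReal |η|⁻¹ * f η) (a * ξ) := hH.comp (measurable_mul_const ξ)
    rw [← lintegral_const_mul _ hHξ,
      ← lintegral_indicator measurableSet_Ioi]
    refine lintegral_congr fun a => ?_
    by_cases ha : 0 < a
    · rw [Set.indicator_of_mem (Set.mem_Ioi.2 ha), Set.indicator_of_mem
        (show a * ξ ∈ {η : ℝ | 0 < η / ξ} by simpa [hξ] using ha), ← mul_assoc,
        ← ENNReal.ofReal_mul (abs_nonneg _), abs_mul, abs_of_pos ha]
      congr 2
      have := abs_pos.2 hξ
      field_simp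
    · rw [Set.indicator_of_notMem (by simpa using ha), Set.indicator_of_notMem
        (show a * ξ ∉ {η : ℝ | 0 < η / ξ} by simpa [hξ] using ha), mul_zero]
  rw [h2, h1, ← mul_assoc, ← ENNReal.ofReal_mul (abs_nonneg _), abs_inv,
    mul_inv_cancel₀ (abs_pos.2 hξ).ne', ENNReal.ofReal_one, one_mul]

/-- The waveforms whose Fourier transform vanishes on `N`. -/
def spectralSubmodule (N : Set ℝ) : Submodule ℂ Waveform where
  carrier := {x | ∀ᵐ ξ : ℝ, ξ ∈ N → (𝓕 x : Waveform) ξ = 0}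
  add_mem' {x y} hx hy := by
    simp only [Set.mem_ofPred_eq, FourierTransform.fourier_add]
    filter_upwards [hx, hy, Lp.coeFn_add (𝓕 x : Waveform) (𝓕 y)] with ξ h1 h2 h3 hξ
    rw [h3, Pi.add_apply, h1 hξ, h2 hξ, add_zero]
  zero_mem' := by
    filter_upwards [fourier_zero_ae] with ξ h1 _
    rw [h1, Pi.zero_apply]
  smul_mem' c x hx := by
    simp only [Set.mem_ofPred_eq, FourierTransform.fourier_smul]
    filter_upwards [hx, Lp.coeFn_smul c (𝓕 x : Waveform)] with ξ h1 h2 hξ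
    rw [h2, Pi.smul_apply, h1 hξ, smul_zero]

/-- The nonzero frequencies outside `N` all have the same sign. -/
def IsHalfLineCompl (N : Set ℝ) : Prop :=
  ∀ ξ η : ℝ, ξ ≠ 0 → η ≠ 0 → ξ ∉ N → η ∉ N → 0 < η / ξ

lemma isHalfLineCompl_Iio : IsHalfLineCompl (Set.Iio 0) := fun _ _ h1 h2 h3 h4 =>
  div_pos (lt_of_le_of_ne (not_lt.1 h4) h2.symm) (lt_of_le_of_ne (not_lt.1 h3) h1.symm)

lemma isHalfLineCompl_Ioi : IsHalfLineCompl (Set.Ioi 0) := fun _ _ h1 h2 h3 h4 =>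
  div_pos_of_neg_of_neg (lt_of_le_of_ne (not_lt.1 h4) h2) (lt_of_le_of_ne (not_lt.1 h3) h1)

/-- After Plancherel in b the weight is a⁻²·a = a⁻¹. Integrating in a first, at fixed ξ outside N,
the half-line of ξ carries the whole spectrum of ψ, so the inner integral is the admissibility
constant, independent of ξ. -/
lemma energy_affine_eq {N : Set ℝ} (hN : IsHalfLineCompl N) {ψ φ : Waveform}
    (hψ : ψ ∈ spectralSubmodule N) (hφ : φ ∈ spectralSubmodule N) :
    energy .affine ψ φ = admissibility ψ * ‖φ‖ₑ ^ 2 := by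
  have hψm : Measurable fun ξ => ‖(𝓕 ψ : Waveform) ξ‖ₑ ^ 2 :=
    ((Lp.stronglyMeasurable (𝓕 ψ : Waveform)).measurable.enorm).pow_const 2
  have hφm : Measurable fun ξ => ‖(𝓕 φ : Waveform) ξ‖ₑ ^ 2 :=
    ((Lp.stronglyMeasurable (𝓕 φ : Waveform)).measurable.enorm).pow_const 2
  have h1 : energy .affine ψ φ = ∫⁻ a, ENNReal.ofReal (((a : ℝ) ^ 2)⁻¹) *
      (∫⁻ b : ℝ, ‖inner ℂ (atomOp a b 0 ψ) φ‖ₑ ^ 2)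
        ∂(Measure.comap (Subtype.val : Set.Ioi (0 : ℝ) → ℝ) volume) :=
    lintegral_haar_affine (F := fun g => ‖inner ℂ (atomOp g.1 g.2 0 ψ) φ‖ₑ ^ 2)
      ((stronglyMeasurable_inner_rep .affine ψ φ).measurable.enorm.pow_const 2)
  have h2 : ∀ a : Set.Ioi (0 : ℝ), ENNReal.ofReal (((a : ℝ) ^ 2)⁻¹) *
      ∫⁻ b : ℝ, ‖inner ℂ (atomOp a b 0 ψ) φ‖ₑ ^ 2
      = ∫⁻ ξ : ℝ, ENNReal.ofReal (a : ℝ)⁻¹ * (‖(𝓕 ψ : Waveform) (a * ξ)‖ₑ ^ 2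
          * ‖(𝓕 φ : Waveform) ξ‖ₑ ^ 2) := fun a => by
    have ha : (0 : ℝ) < a := a.2
    have hm : Measurable fun ξ : ℝ => ‖(𝓕 ψ : Waveform) (a * ξ)‖ₑ ^ 2
        * ‖(𝓕 φ : Waveform) ξ‖ₑ ^ 2 := (hψm.comp (measurable_const_mul (a : ℝ))).mul hφm
    rw [lintegral_enorm_inner_atomOp_sq, lintegral_const_mul _ hm, lintegral_const_mul _ hm,
      ← mul_assoc, ← ENNReal.ofReal_mul (by positivity)]
    congr 2
    field_simp
  rw [h1]
  simp_rw [h2]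
  rw [lintegral_subtype_comap measurableSet_Ioi (fun a : ℝ => ∫⁻ ξ : ℝ, ENNReal.ofReal a⁻¹ *
    (‖(𝓕 ψ : Waveform) (a * ξ)‖ₑ ^ 2 * ‖(𝓕 φ : Waveform) ξ‖ₑ ^ 2))]
  have hm2 : Measurable fun p : ℝ × ℝ => ENNReal.ofReal p.1⁻¹ *
      (‖(𝓕 ψ : Waveform) (p.1 * p.2)‖ₑ ^ 2 * ‖(𝓕 φ : Waveform) p.2‖ₑ ^ 2) :=
    (ENNReal.measurable_ofReal.comp (measurable_inv.comp measurable_fst)).mul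
      ((hψm.comp (measurable_fst.mul measurable_snd)).mul (hφm.comp measurable_snd))
  rw [lintegral_lintegral_swap (f := fun a ξ : ℝ => ENNReal.ofReal a⁻¹ *
    (‖(𝓕 ψ : Waveform) (a * ξ)‖ₑ ^ 2 * ‖(𝓕 φ : Waveform) ξ‖ₑ ^ 2)) hm2.aemeasurable]
  have h3 : ‖φ‖ₑ ^ 2 = ∫⁻ ξ : ℝ, ‖(𝓕 φ : Waveform) ξ‖ₑ ^ 2 := by
    rw [lintegral_enorm_Lp_sq, ← ofReal_norm, ← ofReal_norm, Lp.norm_fourier_eq]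
  rw [h3, ← lintegral_const_mul _ hφm]
  refine lintegral_congr_ae ?_
  filter_upwards [hφ, ae_ne_zero_real] with ξ h4 h5
  by_cases h6 : ξ ∈ N
  · simp [h4 h6]
  simp_rw [← mul_assoc]
  have hm : Measurable fun a : ℝ => ENNReal.ofReal a⁻¹ * ‖(𝓕 ψ : Waveform) (a * ξ)‖ₑ ^ 2 :=
    (ENNReal.measurable_ofReal.comp measurable_inv).mul (hψm.comp (measurable_mul_const ξ))
  rw [lintegral_mul_const _ hm, setLIntegral_comp_mul_right_inv hψm h5, admissibility,
    ← lintegral_indicator (show MeasurableSet {η : ℝ | 0 < η / ξ} from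
      measurableSet_lt measurable_const (measurable_id.div_const ξ))]
  congr 1
  refine lintegral_congr_ae ?_
  filter_upwards [hψ, ae_ne_zero_real] with η h7 h8
  by_cases h9 : η ∈ N
  · simp [Set.indicator, h7 h9]
  · have hη : η ∈ {η : ℝ | 0 < η / ξ} := hN ξ η h5 h8 h6 h9
    rw [Set.indicator_of_mem hη]

/-! ### Admissible vectors and the domain of C_ρ -/

lemma enorm_affineDufloMoore_symbol_sq (ξ : ℝ) :
    ‖((|ξ| ^ (-(1 / 2) : ℝ) : ℝ) : ℂ)‖ₑ ^ 2 = ENNReal.ofReal |ξ|⁻¹ := by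
  rw [← ofReal_norm, ← ENNReal.ofReal_pow (norm_nonneg _), Complex.norm_real,
    Real.norm_of_nonneg (by positivity), ← Real.rpow_natCast, ← Real.rpow_mul (abs_nonneg ξ),
    ← Real.rpow_neg_one]
  norm_num

lemma mem_domain_affineDufloMoore_iff {ψ : Waveform} :
    ψ ∈ affineDufloMoore.domain ↔ admissibility ψ < ∞ := by
  have hm : AEStronglyMeasurable (fun ξ => ((|ξ| ^ (-(1 / 2) : ℝ) : ℝ) : ℂ)
      * (𝓕 ψ : Waveform) ξ) volume :=
    (Complex.measurable_ofReal.comp measurable_affineDufloMoore_symbol).aestronglyMeasurable.mul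
      (Lp.aestronglyMeasurable _)
  rw [affineDufloMoore, mem_domain_fourierMultiplier_iff, memLp_two_iff_lintegral hm,
    admissibility]
  simp_rw [enorm_mul, mul_pow, enorm_affineDufloMoore_symbol_sq]

lemma enorm_affineDufloMoore_sq (ψ : affineDufloMoore.domain) :
    ‖affineDufloMoore ψ‖ₑ ^ 2 = admissibility ψ := by
  have h3 : ‖affineDufloMoore ψ‖ₑ ^ 2
      = ∫⁻ ξ : ℝ, ‖(𝓕 (affineDufloMoore ψ) : Waveform) ξ‖ₑ ^ 2 := by
    rw [lintegral_enorm_Lp_sq, ← ofReal_norm, ← ofReal_norm, Lp.norm_fourier_eq]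
  rw [h3, admissibility]
  refine lintegral_congr_ae ?_
  filter_upwards [fourier_fourierMultiplier_apply ψ] with ξ hξ
  change (𝓕 (affineDufloMoore ψ) : Waveform) ξ = _ at hξ
  rw [hξ, enorm_mul, mul_pow, enorm_affineDufloMoore_symbol_sq]

/-- Polarization: a sesquilinear form that vanishes on the diagonal vanishes. -/
lemma sesquilinear_eq_zero {V : Type*} [AddCommGroup V] [Module ℂ V] {B : V → V → ℂ}
    (hl : ∀ x y z, B (x + y) z = B x z + B y z) (hr : ∀ x y z, B x (y + z) = B x y + B x z)
    (hcl : ∀ (c : ℂ) x y, B (c • x) y = starRingEnd ℂ c * B x y)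
    (hcr : ∀ (c : ℂ) x y, B x (c • y) = c * B x y) (h : ∀ x, B x x = 0) (x y : V) :
    B x y = 0 := by
  have h1 := h (x + y)
  have h2 := h (x + Complex.I • y)
  simp only [hl, hr, hcl, hcr, h, Complex.conj_I, mul_zero, add_zero, zero_add] at h1 h2
  -- `h1` says B x y + B y x = 0 and `h2` says i(B x y - B y x) = 0.
  have h3 : Complex.I * (2 * B x y) = 0 := by linear_combination h2 + Complex.I * h1
  simpa using h3

/-! ### Orthogonality relations by polarization -/

section

variable {N : Set ℝ}

lemma mem_formDomain_affine (hN : IsHalfLineCompl N) {ψ φ : Waveform}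
    (hd : ψ ∈ affineDufloMoore.domain) (hψ : ψ ∈ spectralSubmodule N)
    (hφ : φ ∈ spectralSubmodule N) : φ ∈ formDomain .affine ψ := by
  rw [mem_formDomain_iff, energy_affine_eq hN hψ hφ]
  exact ENNReal.mul_lt_top (mem_domain_affineDufloMoore_iff.1 hd) (by simp)

/-- First polarization, in the analyzed vectors, with ψ fixed; the diagonal is the energy formula.
-/
lemma estForm_affine_eq (hN : IsHalfLineCompl N) (ψ : affineDufloMoore.domain)
    (hψ : (ψ : Waveform) ∈ spectralSubmodule N) {φ₁ φ₂ : Waveform}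
    (h₁ : φ₁ ∈ spectralSubmodule N) (h₂ : φ₂ ∈ spectralSubmodule N) :
    estForm .affine ψ φ₁ φ₂
      = inner ℂ (affineDufloMoore ψ) (affineDufloMoore ψ) * inner ℂ φ₁ φ₂ := by
  have hi : ∀ φ₁ φ₂ : spectralSubmodule N, Integrable (fun g => inner ℂ (φ₁ : Waveform)
      (WaveformGroup.affine.rep g ψ) * inner ℂ (WaveformGroup.affine.rep g ψ) (φ₂ : Waveform))
      WaveformGroup.affine.haar := fun φ₁ φ₂ =>
    integrable_estForm _ (mem_formDomain_affine hN ψ.2 hψ φ₂.2)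
      (mem_formDomain_affine hN ψ.2 hψ φ₁.2)
  refine sub_eq_zero.1 (sesquilinear_eq_zero (V := spectralSubmodule N)
    (B := fun φ₁ φ₂ => estForm .affine ψ φ₁ φ₂
      - inner ℂ (affineDufloMoore ψ) (affineDufloMoore ψ) * inner ℂ (φ₁ : Waveform) φ₂)
    ?_ ?_ ?_ ?_ ?_ ⟨φ₁, h₁⟩ ⟨φ₂, h₂⟩)
  · intro x y z
    simp only [estForm, Submodule.coe_add, inner_add_left, add_mul]
    rw [integral_add (hi x z) (hi y z)]
    ring
  · intro x y z
    simp only [estForm, Submodule.coe_add, inner_add_right, mul_add]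
    rw [integral_add (hi x y) (hi x z)]
    ring
  · intro c x y
    simp only [estForm, Submodule.coe_smul, inner_smul_left, mul_assoc]
    rw [integral_const_mul]
    ring
  · intro c x y
    simp only [estForm, Submodule.coe_smul, inner_smul_right, mul_left_comm _ c]
    rw [integral_const_mul]
    ring
  · intro φ
    simp only [estForm_self]
    rw [energy_affine_eq hN hψ φ.2, ← enorm_affineDufloMoore_sq, inner_self_eq_norm_sq_to_K,
      inner_self_eq_norm_sq_to_K]
    simp

lemma integrable_affine (hN : IsHalfLineCompl N) (ψ₁ ψ₂ : affineDufloMoore.domain)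
    (hψ₁ : (ψ₁ : Waveform) ∈ spectralSubmodule N) (hψ₂ : (ψ₂ : Waveform) ∈ spectralSubmodule N)
    {φ₁ φ₂ : Waveform} (h₁ : φ₁ ∈ spectralSubmodule N) (h₂ : φ₂ ∈ spectralSubmodule N) :
    Integrable (fun g => inner ℂ φ₁ (WaveformGroup.affine.rep g ψ₁)
      * inner ℂ (WaveformGroup.affine.rep g ψ₂) φ₂) WaveformGroup.affine.haar :=
  integrable_inner_mul_inner (mem_formDomain_affine hN ψ₁.2 hψ₁ h₁)
    (mem_formDomain_affine hN ψ₂.2 hψ₂ h₂)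

/-- Second polarization, in the analyzing vectors; its diagonal is `estForm_affine_eq`. The form is
antilinear in ψ₂ and linear in ψ₁, which fixes their order. -/
lemma integral_affine_eq (hN : IsHalfLineCompl N) (ψ₁ ψ₂ : affineDufloMoore.domain)
    (hψ₁ : (ψ₁ : Waveform) ∈ spectralSubmodule N) (hψ₂ : (ψ₂ : Waveform) ∈ spectralSubmodule N)
    {φ₁ φ₂ : Waveform} (h₁ : φ₁ ∈ spectralSubmodule N) (h₂ : φ₂ ∈ spectralSubmodule N) :
    ∫ g, inner ℂ φ₁ (WaveformGroup.affine.rep g ψ₁)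
      * inner ℂ (WaveformGroup.affine.rep g ψ₂) φ₂ ∂WaveformGroup.affine.haar
      = inner ℂ (affineDufloMoore ψ₂) (affineDufloMoore ψ₁) * inner ℂ φ₁ φ₂ := by
  let V := (spectralSubmodule N).comap affineDufloMoore.domain.subtype
  have hi : ∀ x y : V, Integrable (fun g => inner ℂ φ₁ (WaveformGroup.affine.rep g y.1)
      * inner ℂ (WaveformGroup.affine.rep g x.1) φ₂) WaveformGroup.affine.haar := fun x y =>
    integrable_affine hN y.1 x.1 y.2 x.2 h₁ h₂
  refine sub_eq_zero.1 (sesquilinear_eq_zero (V := V)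
    (B := fun x y => ∫ g, inner ℂ φ₁ (WaveformGroup.affine.rep g y.1)
      * inner ℂ (WaveformGroup.affine.rep g x.1) φ₂ ∂WaveformGroup.affine.haar
      - inner ℂ (affineDufloMoore x.1) (affineDufloMoore y.1) * inner ℂ φ₁ φ₂)
    ?_ ?_ ?_ ?_ ?_ ⟨ψ₂, hψ₂⟩ ⟨ψ₁, hψ₁⟩)
  · intro x y z
    simp only [Submodule.coe_add, map_add, LinearPMap.map_add, inner_add_left, mul_add, add_mul]
    rw [integral_add (hi x z) (hi y z)]
    ring
  · intro x y z
    simp only [Submodule.coe_add, map_add, LinearPMap.map_add, inner_add_right, add_mul]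
    rw [integral_add (hi x y) (hi x z)]
    ring
  · intro c x y
    simp only [Submodule.coe_smul, map_smul, LinearPMap.map_smul, inner_smul_left,
      mul_left_comm _ (starRingEnd ℂ c)]
    rw [integral_const_mul]
    ring
  · intro c x y
    simp only [Submodule.coe_smul, map_smul, LinearPMap.map_smul, inner_smul_right, mul_assoc]
    rw [integral_const_mul]
    ring
  · intro x
    exact sub_eq_zero.2 (estForm_affine_eq hN x.1 x.2 h₁ h₂)

lemma isDufloMooreOn_spectralSubmodule (hN : IsHalfLineCompl N) :
    IsDufloMooreOn .affine (spectralSubmodule N) affineDufloMoore where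
  mapsTo ψ hψ := by
    change ∀ᵐ ξ : ℝ, ξ ∈ N → (𝓕 (affineDufloMoore ψ) : Waveform) ξ = 0
    have hψ' : ∀ᵐ ξ : ℝ, ξ ∈ N → (𝓕 (ψ : Waveform) : Waveform) ξ = 0 := hψ
    filter_upwards [hψ', fourier_fourierMultiplier_apply ψ] with ξ h1 h2 hξ
    change (𝓕 (affineDufloMoore ψ) : Waveform) ξ = _ at h2
    rw [h2, h1 hξ, mul_zero]
  mem_domain_iff ψ hψ := by
    change _ ↔ ψ ∈ formDomain .affine ψ
    refine ⟨fun h => mem_formDomain_affine hN h hψ hψ, fun h => ?_⟩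
    -- The factor ‖ψ‖² can be cancelled from the finite energy only if it is nonzero.
    by_cases h0 : ψ = 0
    · rw [h0]; exact zero_mem _
    rw [mem_formDomain_iff, energy_affine_eq hN hψ hψ] at h
    rw [mem_domain_affineDufloMoore_iff]
    exact (ENNReal.lt_top_of_mul_ne_top_left h.ne (by simpa using h0))
  orthogonality ψ₁ ψ₂ hψ₁ hψ₂ φ₁ h₁ φ₂ h₂ :=
    ⟨integrable_affine hN ψ₁ ψ₂ hψ₁ hψ₂ h₁ h₂, integral_affine_eq hN ψ₁ ψ₂ hψ₁ hψ₂ h₁ h₂⟩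

end

end

/-! ### The replacement theorem -/

theorem mainTheorem2 (G : WaveformGroup)
    {Ω : Type*} [MeasurableSpace Ω] (P : Measure Ω) [IsProbabilityMeasure P]
    (s : Waveform) (n : Ω → Waveform) (σ : ℝ)
    (S : Submodule ℂ Waveform) (hS_closed : IsClosed (S : Set Waveform))
    (hS_inv : ∀ g : G.Elt, ∀ f ∈ S, G.rep g f ∈ S) (hs : s ∈ S)
    (hn_meas : AEStronglyMeasurable n P)
    (hn_mean : ∀ u : Waveform,
      Integrable (fun ω => inner ℂ u (n ω)) P ∧ ∫ ω, inner ℂ u (n ω) ∂P = 0) :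
    -- (i) decomposition, in the sense of quadratic forms with values in `[0, ∞]`
    (∀ u : Waveform, ∫⁻ ω, energy G (s + n ω) u ∂P
      = energy G s u + ∫⁻ ω, energy G (n ω) u ∂P) ∧
    -- (i) the cross term has mean zero
    (∀ u v : Waveform, energy G s u < ∞ → energy G s v < ∞ →
      ∫⁻ ω, energy G (n ω) u ∂P < ∞ → ∫⁻ ω, energy G (n ω) v ∂P < ∞ →
      Integrable (fun ω => crossForm G s (n ω) v u) P ∧
      ∫ ω, crossForm G s (n ω) v u ∂P = 0) ∧
    -- (i) `E[F_G(x)] = F_G(s) + σ² N_G` under noise ergodicity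
    (HasMeanEstimator G P n (((σ ^ 2 : ℝ) : ℂ) • noiseOperator G) →
      HasMeanEstimator G P (fun ω => s + n ω)
        (estimator G s + ((σ ^ 2 : ℝ) : ℂ) • noiseOperator G)) ∧
    -- (ii) signal concentration
    (LinearMap.range (estimator G s).toFun ≤ S) ∧
    (FiniteDimensional ℂ S →
      Module.finrank ℂ (LinearMap.range (estimator G s).toFun) = Module.finrank ℂ S) ∧
    -- (iii) flat noise floor for the unimodular groups
    (G = .translation ∨ G = .timeFrequency →
      HasMeanEstimator G P n (((σ ^ 2 : ℝ) : ℂ) • noiseOperator G) →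
      ∀ u : Waveform, ∫⁻ ω, energy G (s + n ω) u ∂P
        = energy G s u + ENNReal.ofReal (σ ^ 2) * ‖u‖ₑ ^ 2) ∧
    -- (iii) frequency-dependent noise floor for the affine group
    (IsSelfAdjoint affineDufloMoore ∧
      (∀ ψ : affineDufloMoore.domain,
        0 ≤ (inner ℂ (ψ : Waveform) (affineDufloMoore ψ)).re) ∧
      IsDufloMooreOn .affine positiveFrequency affineDufloMoore ∧
      IsDufloMooreOn .affine negativeFrequency affineDufloMoore ∧
      noiseOperator .affine = fourierMultiplier fun ω => |ω|) ∧
    (G = .affine →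
      HasMeanEstimator G P n (((σ ^ 2 : ℝ) : ℂ) • noiseOperator G) →
      ∀ u ∈ (noiseOperator G).domain, ∫⁻ ω, energy G (s + n ω) u ∂P
        = energy G s u + ENNReal.ofReal (σ ^ 2) *
          ∫⁻ ξ : ℝ, ENNReal.ofReal |ξ| * ‖(𝓕 u : Waveform) ξ‖ₑ ^ 2) ∧
    -- (iv) subspace separation, for the eigenvalues that dominate the noise
    (∀ ω : Ω, (∃ K : ℝ, ∀ u : Waveform, energy G (n ω) u ≤ ENNReal.ofReal K * ‖u‖ₑ ^ 2) →
      ∀ (t l : ℕ → ℝ) (v : ℕ → Waveform),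
      (∀ k, 0 < l k) → Tendsto (fun k => t k ^ 2 / l k) atTop (𝓝 0) →
      (∀ k, ‖v k‖ = 1 ∧ IsEigenfunction (estimator G (s + (t k : ℂ) • n ω)) (l k) (v k)) →
      Tendsto (fun k => Metric.infDist (v k) (S : Set Waveform)) atTop (𝓝 0)) ∧
    -- (iv) subspace separation, for the `dim S` largest eigenvalues
    (FiniteDimensional ℂ S → ∀ (ω : Ω) (t : ℕ → ℝ)
      (v : ℕ → Fin (Module.finrank ℂ S) → Waveform),
      Tendsto t atTop (𝓝 0) →
      (∀ k, IsTopEigenfamily (estimator G (s + (t k : ℂ) • n ω)) (v k)) →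
      (∀ i, Tendsto (fun k => Metric.infDist (v k i) (S : Set Waveform)) atTop (𝓝 0)) ∧
      ∀ f ∈ S, Tendsto (fun k => Metric.infDist f
        (Submodule.span ℂ (Set.range (v k)) : Set Waveform)) atTop (𝓝 0)) := by
  refine ⟨fun u => lintegral_energy_add G s hn_meas hn_mean u,
    fun u v h1 h2 h3 h4 => crossForm_mean_zero G s hn_meas hn_mean h1 h2 h3 h4,
    fun h => h.signal_add G s hn_meas hn_mean,
    range_estimator_le G hS_closed hS_inv hs, fun hfin => ?_, fun hG h u => ?_,
    ⟨isSelfAdjoint_fourierMultiplier measurable_affineDufloMoore_symbol, affineDufloMoore_nonneg,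
      isDufloMooreOn_spectralSubmodule isHalfLineCompl_Iio,
      isDufloMooreOn_spectralSubmodule isHalfLineCompl_Ioi, inverseSquare_affineDufloMoore⟩,
    fun hG h u hu => ?_,
    fun ω ⟨K, hK⟩ t l v hl ht hv =>
      tendsto_infDist_of_eigenfunction G hS_closed hS_inv hs hK hl ht hv,
    fun hfin ω t v _ _ => ?_⟩
  · have hbot := eq_bot_of_finiteDimensional_of_invariant G hS_inv
    have hr := range_estimator_le G hS_closed hS_inv hs
    rw [hbot, le_bot_iff] at hr
    rw [hr, hbot]
  · rw [lintegral_energy_add G s hn_meas hn_mean]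
    congr 1
    have hN : noiseOperator G = LinearMap.id.toPMap ⊤ := by rcases hG with rfl | rfl <;> rfl
    rw [hN] at h
    refine lintegral_energy_of_hasMeanEstimator_smul G hn_meas (sq_nonneg σ) h
      ⟨u, Submodule.mem_top⟩ (by simp) ?_
    change inner ℂ u u = _
    rw [inner_self_eq_norm_sq_to_K]
    simp
  · rw [lintegral_energy_add G s hn_meas hn_mean]
    congr 1
    subst hG
    rw [show noiseOperator .affine = fourierMultiplier fun ξ => |ξ| from
      inverseSquare_affineDufloMoore] at h hu
    obtain ⟨hI, hi⟩ := inner_fourierMultiplier_self (fun ξ => abs_nonneg ξ) ⟨u, hu⟩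
    exact lintegral_energy_of_hasMeanEstimator_smul _ hn_meas (sq_nonneg σ) h ⟨u, hu⟩ hI hi
  · have hbot := eq_bot_of_finiteDimensional_of_invariant G hS_inv
    have hd : Module.finrank ℂ S = 0 := by rw [hbot, finrank_bot]
    -- As S = 0, the family of eigenfunctions is empty and f = 0.
    refine ⟨fun i => absurd i.2 (by omega), fun f hf => ?_⟩
    rw [hbot, Submodule.mem_bot] at hf
    have h0 : ∀ k, Metric.infDist f (Submodule.span ℂ (Set.range (v k)) : Set Waveform) = 0 :=
      fun k => Metric.infDist_zero_of_mem (by rw [hf]; exact zero_mem _)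
    simp only [h0]
    exact tendsto_const_nhds
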